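/- Composite stochastic block model. Let $1\le k\le n$ and $N=n(n-1)/2$, let $\xi=(\xi_1,\dots,\xi_n)$ be i.i.d. real latent variables, and let $f(x,y)=Q_{c(x)c(y)}$ with $c:\mathbb R\to[k]$ measurable and $Q\in[0,1]^{k\times k}$ symmetric (block-wise constant $f$ with $k$ groups). Put $\theta_{ij}=f(\xi_i,\xi_j)$ for $i\ne j$ and $\theta_{ii}=0$. The symmetric $0$-$1$ adjacency matrix $A$ has zero diagonal, and for some bijection $\omega$ from the unordered pairs $\{i,j\}$, $i\neq j$, onto $\{1,\dots,N\}$ the ordered edge variables $B_{\omega(\{i,j\})}=A_{ij}$, extended by burn-in variables $B_s$, $s\le 0$, that are i.i.d. Bernoulli$(1/2)$ and independent of $(B_1,\dots,B_N)$, satisfy conditionally on $\xi$: * $\mathbb P(A_{ij}=1\mid\xi)=\theta_{ij}$ for all $i\ne j$; * for $1\le i\le N$ the conditional law of $B_i$ given $B_{i-1},B_{i-2},\dots$ depends only on $B_{i-1},\dots,B_{i-l}$ (memory $l\ge 0$); * with $U_i=(B_i,\dots,B_{i-l+1})$, $\mathbb P(U_i=a\mid U_{i-l}=b,\xi)\ge\alpha'>0$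 for all $a,b\in\{0,1\}^l$ and $1\le i\le N$. Put $\chi=(1-2\alpha')^{1/l}$ if $l\ge1$, and $\chi=0$ if $l=0$ (conditionally independent edges). Let $\Theta_k$ be the set of $\theta\in[0,1]^{n\times n}$ for which there are a symmetric $Q\in[0,1]^{k\times k}$ and $z:[n]\to[k]$ with $\theta_{ii}=0$ and $\theta_{ij}=Q_{z(i)z(j)}$ for $i\ne j$. The combinatorial least-squares estimator is $\hat\theta_{ij}=\hat Q_{\hat z(i)\hat z(j)}$ for $i\ne j$, $\hat\theta_{ii}=0$, where $(\hat Q,\hat z)$ is any minimizer of $\sum_{i<j}(A_{ij}-Q_{z(i)z(j)})^2$ over symmetric $Q\in\mathbb R^{k\times k}$ and $z:[n]\to[k]$. Theorem. (1) For every $C'>0$ there is $C>0$ depending only on $C'$ such that, for all such models, $$\frac1{n^2}\sum_{i,j\in[n]}(\hat\theta_{ij}-\theta_{ij})^2\le C\Big(\frac{k^2}{n^2}+\frac{\log k}{n}\Big)(1-\chi)^{-2}$$ with probability at least $1-\exp(-C'n\log k)$. This holds conditionally on the latent variables, uniformly over $\theta\in\Theta_k$ (that is, for every $\theta\in\Theta_k$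 and every admissible conditional law of the edges with connection probabilities $\theta$), and also unconditionally. (2) There is a universal constant $C_1>0$ such that, for all $n$, all $k\in[n]$ and all such models, $$\sup_{\theta\in\Theta_k}\mathbb E\Big\{\frac1{n^2}\sum_{i,j\in[n]}(\hat\theta_{ij}-\theta_{ij})^2\Big\}\le C_1\Big(\frac{k^2}{n^2}+\frac{\log k}{n}\Big)(1-\chi)^{-2},$$ where the expectation is conditional on the latent variables, and the same bound holds for the unconditional expectation. -/

import Mathlib

open MeasureTheory ProbabilityTheory

noncomputable section

namespace CompositeSBM

/-- The squared Frobenius loss divided by `n ^ 2`. -/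
def normSqError {n : ℕ} (S T : Fin n → Fin n → ℝ) : ℝ :=
  (1 / (n : ℝ) ^ 2) * ∑ i, ∑ j, (S i j - T i j) ^ 2

/-- The class `Θ_k`: matrices with entries in `[0, 1]` and zero diagonal that are constant on the
blocks of some assignment `z` of the `n` nodes to `k` groups. -/
def blockMatrices (n k : ℕ) : Set (Fin n → Fin n → ℝ) :=
  {θ | ∃ (Q : Fin k → Fin k → ℝ) (z : Fin n → Fin k),
    (∀ a b, Q a b ∈ Set.Icc (0 : ℝ) 1) ∧ (∀ a b, Q a b = Q b a) ∧
    (∀ i, θ i i = 0) ∧ ∀ i j, i ≠ j → θ i j = Q (z i) (z j)}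

/-- The least-squares criterion `L(Q, z)` for the observed adjacency matrix `A`. -/
def leastSquaresLoss {n k : ℕ} (A : Fin n → Fin n → Bool) (Q : Fin k → Fin k → ℝ)
    (z : Fin n → Fin k) : ℝ :=
  ∑ i, ∑ j, if i < j then ((if A i j then (1 : ℝ) else 0) - Q (z i) (z j)) ^ 2 else 0

/-- `T` is a combinatorial least-squares estimate with `k` groups for the adjacency matrix `A`:
`T i j = Q (z i) (z j)` off the diagonal and `T i i = 0`, where `(Q, z)` minimizes the
least-squares criterion over all symmetric real matrices and all assignments. -/
def IsLeastSquaresEstimate {n : ℕ} (k : ℕ) (A : Fin n → Fin n → Bool)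
    (T : Fin n → Fin n → ℝ) : Prop :=
  ∃ (Q : Fin k → Fin k → ℝ) (z : Fin n → Fin k),
    (∀ a b, Q a b = Q b a) ∧
    (∀ (Q' : Fin k → Fin k → ℝ) (z' : Fin n → Fin k), (∀ a b, Q' a b = Q' b a) →
      leastSquaresLoss A Q z ≤ leastSquaresLoss A Q' z') ∧
    (∀ i, T i i = 0) ∧ ∀ i j, i ≠ j → T i j = Q (z i) (z j)

/-- The number `N = n (n - 1) / 2` of unordered pairs of distinct nodes. -/
def numPairs (n : ℕ) : ℕ := n * (n - 1) / 2

/-- `ω` is an order of the edge variables: a bijection from the unordered pairs of distinct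
nodes to `{1, …, N}`.  (The values of `ω` on the diagonal are never used.) -/
def IsEdgeOrder (n : ℕ) (ω : Sym2 (Fin n) → ℤ) : Prop :=
  Set.BijOn ω {e | ¬ e.IsDiag} (Set.Icc 1 (numPairs n : ℤ))

/-- The adjacency matrix obtained from the ordered edge variables: `A_{ij} = B_{ω {i, j}}`. -/
def adjacency {n : ℕ} (ω : Sym2 (Fin n) → ℤ) (B : ℤ → Bool) : Fin n → Fin n → Bool :=
  fun i j => if i = j then false else B (ω s(i, j))

/-- The state `U_i = (B_i, B_{i-1}, …, B_{i-l+1})`. -/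
def state (l : ℕ) (i : ℤ) (B : ℤ → Bool) : Fin l → Bool := fun r => B (i - (r : ℤ))

/-- The event `B_{i-1} = b_{i-1}, …, B_{i-m} = b_{i-m}`. -/
def pastEvent (m : ℕ) (i : ℤ) (b : ℤ → Bool) : Set (ℤ → Bool) :=
  {B | ∀ j, i - (m : ℤ) ≤ j → j < i → B j = b j}

/-- The burn-in variables `B_j`, `j ≤ 0`, are i.i.d. Bernoulli(1/2) and independent of
`B_1, …, B_N`. -/
def IsBurnIn (N : ℕ) (μ : Measure (ℤ → Bool)) : Prop :=
  (∀ j : ℤ, j ≤ 0 → μ.real {B | B j = true} = 1 / 2) ∧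
  iIndepFun (fun (j : Set.Iic (0 : ℤ)) (B : ℤ → Bool) => B j) μ ∧
  IndepFun (fun (B : ℤ → Bool) (j : Set.Iic (0 : ℤ)) => B j)
    (fun (B : ℤ → Bool) (j : Set.Icc (1 : ℤ) (N : ℤ)) => B j) μ

/-- `B_1, …, B_N` (with their burn-in past) form a Markov chain of order `l`: the conditional
law of `B_i` given a past of any length `m ≥ l` depends on the last `l` values only. -/
def IsMarkovOfOrder (N l : ℕ) (μ : Measure (ℤ → Bool)) : Prop :=
  ∀ i : ℤ, 1 ≤ i → i ≤ (N : ℤ) → ∀ m : ℕ, l ≤ m → ∀ b : ℤ → Bool,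
    μ (pastEvent m i b) ≠ 0 →
      μ[|pastEvent m i b] {B | B i = true} = μ[|pastEvent l i b] {B | B i = true}

/-- `P(U_i = a | U_{i-l} = b) ≥ α` for all states `a`, `b` and all `1 ≤ i ≤ N`. -/
def HasTransitionBound (N l : ℕ) (α : ℝ) (μ : Measure (ℤ → Bool)) : Prop :=
  ∀ i : ℤ, 1 ≤ i → i ≤ (N : ℤ) → ∀ a b : Fin l → Bool,
    α ≤ (μ[|{B | state l (i - (l : ℤ)) B = b}]).real {B | state l i B = a}

/-- The dependence parameter `χ = (1 - 2 α) ^ (1 / l)`; for independent edge variables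
(`l = 0`) it is `0`. -/
def chi (l : ℕ) (α : ℝ) : ℝ := if l = 0 then 0 else (1 - 2 * α) ^ (1 / (l : ℝ))

/-- `μ` is an admissible conditional law, given the latent variables, of the ordered edge
variables of a composite graphon model whose connection probabilities are `θ`. -/
structure IsEdgeLaw (n l : ℕ) (α : ℝ) (ω : Sym2 (Fin n) → ℤ) (θ : Fin n → Fin n → ℝ)
    (μ : Measure (ℤ → Bool)) : Prop where
  burnIn : IsBurnIn (numPairs n) μ
  markov : IsMarkovOfOrder (numPairs n) l μ
  transition : HasTransitionBound (numPairs n) l α μ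
  marginal : ∀ i j, i ≠ j → μ.real {B | adjacency ω B i j = true} = θ i j

/-- `f` is symmetric, `[0, 1]`-valued and block-wise constant with `k` groups. -/
def IsBlockwiseConstant (k : ℕ) (f : ℝ → ℝ → ℝ) : Prop :=
  ∃ (c : ℝ → Fin k) (Q : Fin k → Fin k → ℝ), Measurable c ∧
    (∀ a b, Q a b ∈ Set.Icc (0 : ℝ) 1) ∧ (∀ a b, Q a b = Q b a) ∧
    ∀ x y, f x y = Q (c x) (c y)

/-- The matrix `θ_{ij} = f (ξ_i, ξ_j)`, `i ≠ j`, with zero diagonal. -/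
def graphonMatrix {n : ℕ} (f : ℝ → ℝ → ℝ) (ξ : Fin n → ℝ) : Fin n → Fin n → ℝ :=
  fun i j => if i = j then 0 else f (ξ i) (ξ j)

/-- The joint law of `(ξ, B)`, where `ξ_1, …, ξ_n` are i.i.d. with law `ν` and `κ ξ` is the
conditional law of the ordered edge variables given `ξ`. -/
def jointLaw (n : ℕ) (ν : Measure ℝ) (κ : Kernel (Fin n → ℝ) (ℤ → Bool)) :
    Measure ((Fin n → ℝ) × (ℤ → Bool)) :=
  (Measure.pi fun _ : Fin n => ν) ⊗ₘ κ

/-- The composite stochastic block model with `k` groups: i.i.d. latent variables with law `ν`,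
a block-wise constant `f`, and conditional edge laws `κ ξ`. -/
structure IsCompositeSBM (n k l : ℕ) (α : ℝ) (ω : Sym2 (Fin n) → ℤ) (ν : Measure ℝ)
    (f : ℝ → ℝ → ℝ) (κ : Kernel (Fin n → ℝ) (ℤ → Bool)) : Prop where
  blocks : IsBlockwiseConstant k f
  edges : ∀ᵐ ξ ∂(Measure.pi fun _ : Fin n => ν),
    IsEdgeLaw n l α ω (graphonMatrix f ξ) (κ ξ)

end CompositeSBM

end

open MeasureTheory ProbabilityTheory CompositeSBM

/-! Everything rests on one fact about the noise: a linear statistic of the centred edge variables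
with coefficients `c` is sub-Gaussian with variance proxy `‖c‖² / (1 - χ)²`
(`integral_exp_sum_centered_le`). This is the martingale method along the edge order. Given the
past, every state is reached in `l` steps with probability at least `α`. Hence revealing one
variable moves the conditional expectation of the variable `m` steps later by at most `(1 - 2α) ^ ⌊m
/ l⌋` (`chainExp_coord_sub_le`). These weights sum to at most `l / (2α) ≤ 2 / (1 - χ)`, Schur's test
converts this into a bound on the sum of squared increments, and Hoeffding's lemma handles each
increment. The martingale starts at a constant because the burn-in is independent of the edges.

The least-squares part needs neither a net nor truncation of the estimate. With `d` the error,
minimality gives `‖d‖² ≤ 4⟨noise, d⟩ - ‖d‖²`. For a fixed assignment the supremum of the right side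
over `Q` is explicit: squared projections of the noise on block indicators, and a linear form
orthogonal to them. Writing the exponential of a square as a Gaussian integral of linear
exponentials costs a factor `√2` per block (`sum_exp_offsetSup_le`). Summing over the `k ^ n`
assignments yields `E exp(n² (1 - χ)² / 32 * loss) ≤ exp(k² + n log k)`
(`integral_exp_normSqError_le`). Markov's inequality then gives the tail and convexity of `exp` the
mean; the unconditional bounds follow by integrating over the latent variables. -/

namespace CompositeSBM

/-! ### Iterated conditional expectations as explicit operators. -/

/-- The indicator of `B_r = 1`. -/
def coord (r : ℤ) (b : ℤ → Bool) : ℝ := if b r then 1 else 0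

/-- Integration over the `i`-th variable when, given the past, it is `1` with probability `g i`. -/
def stepOp (g : ℤ → (ℤ → Bool) → ℝ) (i : ℤ) :
    ((ℤ → Bool) → ℝ) →ₗ[ℝ] ((ℤ → Bool) → ℝ) where
  toFun F b := g i b * F (Function.update b i true) + (1 - g i b) * F (Function.update b i false)
  map_add' F G := by ext b; simp only [Pi.add_apply]; ring
  map_smul' c F := by ext b; simp only [Pi.smul_apply, smul_eq_mul, RingHom.id_apply]; ring

lemma stepOp_apply (g : ℤ → (ℤ → Bool) → ℝ) (i : ℤ) (F : (ℤ → Bool) → ℝ) (b : ℤ → Bool) :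
    stepOp g i F b = g i b * F (Function.update b i true)
      + (1 - g i b) * F (Function.update b i false) := rfl

/-- Integration over the variables `j + 1, …, j + m` given the past up to time `j`. -/
def chainExp (g : ℤ → (ℤ → Bool) → ℝ) : ℕ → ℤ → ((ℤ → Bool) → ℝ) →ₗ[ℝ] ((ℤ → Bool) → ℝ)
  | 0, _ => LinearMap.id
  | m + 1, j => stepOp g (j + 1) ∘ₗ chainExp g m (j + 1)

section ChainExp
variable {g : ℤ → (ℤ → Bool) → ℝ}

@[simp] lemma chainExp_zero (j : ℤ) (F : (ℤ → Bool) → ℝ) : chainExp g 0 j F = F := rfl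

lemma chainExp_succ (m : ℕ) (j : ℤ) (F : (ℤ → Bool) → ℝ) :
    chainExp g (m + 1) j F = stepOp g (j + 1) (chainExp g m (j + 1) F) := rfl

/-- The tower property. -/
lemma chainExp_add (a b : ℕ) (j : ℤ) (F : (ℤ → Bool) → ℝ) :
    chainExp g (a + b) j F = chainExp g a j (chainExp g b (j + a) F) := by
  induction a generalizing j with
  | zero => simp
  | succ a ih =>
    rw [Nat.add_right_comm, chainExp_succ, ih, chainExp_succ]
    congr 3
    push_cast; ring_nf

lemma stepOp_mul_left (i : ℤ) {Φ : (ℤ → Bool) → ℝ} (hΦ : DependsOn Φ (Set.Iio i))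
    (F : (ℤ → Bool) → ℝ) : stepOp g i (Φ * F) = Φ * stepOp g i F := by
  have h (b : ℤ → Bool) (t : Bool) : Φ (Function.update b i t) = Φ b :=
    hΦ fun j hj => Function.update_of_ne (ne_of_lt hj) _ _
  ext b
  simp only [stepOp_apply, Pi.mul_apply, h]
  ring

lemma stepOp_const (i : ℤ) (c : ℝ) : stepOp g i (fun _ => c) = fun _ => c := by
  ext b; simp only [stepOp_apply]; ring

lemma chainExp_const (m : ℕ) (j : ℤ) (c : ℝ) : chainExp g m j (fun _ => c) = fun _ => c := by
  induction m generalizing j with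
  | zero => rfl
  | succ m ih => rw [chainExp_succ, ih, stepOp_const]

/-- Factors already known at time `j` are not touched by integration over later variables. -/
lemma chainExp_mul_left (m : ℕ) (j : ℤ) {Φ : (ℤ → Bool) → ℝ} (hΦ : DependsOn Φ (Set.Iic j))
    (F : (ℤ → Bool) → ℝ) : chainExp g m j (Φ * F) = Φ * chainExp g m j F := by
  induction m generalizing j with
  | zero => rfl
  | succ m ih =>
    rw [chainExp_succ, ih (j + 1) (hΦ.mono (Set.Iic_subset_Iic.2 (by lia))),
      stepOp_mul_left _ (hΦ.mono fun x hx => by simp at *; lia), chainExp_succ]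

lemma chainExp_of_dependsOn (m : ℕ) (j : ℤ) {Φ : (ℤ → Bool) → ℝ}
    (hΦ : DependsOn Φ (Set.Iic j)) : chainExp g m j Φ = Φ := by
  have := chainExp_mul_left (g := g) m j hΦ (fun _ => 1)
  rw [chainExp_const] at this
  have h1 : Φ * (fun _ => (1 : ℝ)) = Φ := by ext; simp
  rwa [h1] at this

section Bounds
variable (hg0 : ∀ i b, 0 ≤ g i b) (hg1 : ∀ i b, g i b ≤ 1)
include hg0 hg1

lemma stepOp_mono (i : ℤ) {F G : (ℤ → Bool) → ℝ} (h : F ≤ G) : stepOp g i F ≤ stepOp g i G := by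
  intro b
  rw [stepOp_apply, stepOp_apply]
  exact add_le_add (mul_le_mul_of_nonneg_left (h _) (hg0 i b))
    (mul_le_mul_of_nonneg_left (h _) (sub_nonneg.2 (hg1 i b)))

lemma chainExp_mono (m : ℕ) (j : ℤ) {F G : (ℤ → Bool) → ℝ} (h : F ≤ G) :
    chainExp g m j F ≤ chainExp g m j G := by
  induction m generalizing j with
  | zero => exact h
  | succ m ih => exact stepOp_mono hg0 hg1 _ (ih _)

end Bounds

section Dependence
variable {l : ℕ} (hgd : ∀ i, DependsOn (g i) (Set.Icc (i - (l : ℤ)) (i - 1)))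
include hgd

lemma dependsOn_stepOp {s i : ℤ} {F : (ℤ → Bool) → ℝ} (hF : DependsOn F (Set.Icc s i)) :
    DependsOn (stepOp g i F) (Set.Icc (min s (i - l)) (i - 1)) := by
  intro x y hxy
  have h1 : g i x = g i y := hgd i fun j hj => hxy j (by simp at *; lia)
  have h2 (t : Bool) : F (Function.update x i t) = F (Function.update y i t) := by
    refine hF fun j hj => ?_
    by_cases hji : j = i
    · subst hji; simp
    · rw [Function.update_of_ne hji, Function.update_of_ne hji]
      exact hxy j (by simp at *; lia)
  rw [stepOp_apply, stepOp_apply, h1, h2, h2]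

/-- The transition probabilities bring in only the `l` variables up to `j`. For `s > j` the window
is therefore one state, and for `l = 0` it is empty; both cases are used. -/
lemma dependsOn_chainExp {s : ℤ} (m : ℕ) (j : ℤ) {F : (ℤ → Bool) → ℝ}
    (hF : DependsOn F (Set.Icc s (j + m))) :
    DependsOn (chainExp g m j F) (Set.Icc (min s (j + 1 - l)) j) := by
  induction m generalizing j with
  | zero => exact hF.mono (Set.Icc_subset_Icc (min_le_left _ _) (by simp))
  | succ m ih =>
    have h1 := ih (j + 1) (by convert hF using 2; push_cast; ring)
    refine (dependsOn_stepOp hgd h1).mono ?_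
    intro x hx; simp at *; lia

end Dependence

lemma dependsOn_coord (r : ℤ) : DependsOn (coord r) {r} := by
  intro x y h
  simp only [coord, h r rfl]

/-! ### Functions of finitely many variables. -/

/-- `F` depends on finitely many variables up to time `i`. -/
def FinDep (i : ℤ) (F : (ℤ → Bool) → ℝ) : Prop := ∃ s, DependsOn F (Set.Icc s i)

lemma FinDep.mono {i j : ℤ} (hij : i ≤ j) {F : (ℤ → Bool) → ℝ} (h : FinDep i F) : FinDep j F :=
  h.imp fun _ hs => hs.mono (Set.Icc_subset_Icc_right hij)

lemma FinDep.comp {i : ℤ} {F : (ℤ → Bool) → ℝ} (h : FinDep i F) (φ : ℝ → ℝ) :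
    FinDep i (fun b => φ (F b)) :=
  h.imp fun _ hs _ _ hxy => congrArg φ (hs hxy)

lemma FinDep.comp₂ {i : ℤ} {F G : (ℤ → Bool) → ℝ} (h : FinDep i F) (h' : FinDep i G)
    (φ : ℝ → ℝ → ℝ) : FinDep i (fun b => φ (F b) (G b)) := by
  obtain ⟨s, hs⟩ := h
  obtain ⟨t, ht⟩ := h'
  refine ⟨min s t, fun x y hxy => ?_⟩
  change φ (F x) (G x) = φ (F y) (G y)
  rw [hs fun j hj => hxy j ⟨(min_le_left _ _).trans hj.1, hj.2⟩,
    ht fun j hj => hxy j ⟨(min_le_right _ _).trans hj.1, hj.2⟩]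

lemma finDep_const (i : ℤ) (c : ℝ) : FinDep i (fun _ => c) := ⟨0, fun _ _ _ => rfl⟩

lemma finDep_coord {r i : ℤ} (h : r ≤ i) : FinDep i (coord r) :=
  ⟨r, (dependsOn_coord r).mono (by simpa using h)⟩

lemma FinDep.sum {ι : Type*} {i : ℤ} {F : ι → (ℤ → Bool) → ℝ} (s : Finset ι)
    (h : ∀ a ∈ s, FinDep i (F a)) : FinDep i (∑ a ∈ s, F a) := by
  classical
  induction s using Finset.induction_on with
  | empty => exact finDep_const i 0
  | insert a s ha ih =>
    rw [Finset.sum_insert ha]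
    exact (h a (by simp)).comp₂ (ih fun b hb => h b (by simp [hb])) (· + ·)

lemma FinDep.exists_restrict {i : ℤ} {F : (ℤ → Bool) → ℝ} (h : FinDep i F) :
    ∃ (s : Set ℤ) (_ : Finite s) (G : (s → Bool) → ℝ), F = G ∘ s.domRestrict := by
  obtain ⟨s, hs⟩ := h
  obtain ⟨G, hG⟩ := dependsOn_iff_exists_comp.1 hs
  exact ⟨_, (Set.finite_Icc s i).to_subtype, G, hG⟩

lemma FinDep.measurable {i : ℤ} {F : (ℤ → Bool) → ℝ} (h : FinDep i F) : Measurable F := by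
  obtain ⟨s, hs, G, rfl⟩ := h.exists_restrict
  exact (measurable_of_finite G).comp (measurable_pi_lambda _ fun j => measurable_pi_apply _)

/-- Such a function takes finitely many values, so both extremes are attained. -/
lemma FinDep.exists_bound {i : ℤ} {F : (ℤ → Bool) → ℝ} (h : FinDep i F) :
    ∃ a b, (∀ x, F a ≤ F x) ∧ ∀ x, F x ≤ F b := by
  obtain ⟨s, hs, G, rfl⟩ := h.exists_restrict
  have hsurj : Function.Surjective (s.domRestrict (π := fun _ : ℤ => Bool)) := fun w => by
    classical
    exact ⟨fun j => if hj : j ∈ s then w ⟨j, hj⟩ else false, by ext j; simp⟩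
  obtain ⟨a, ha⟩ := Finite.exists_min G
  obtain ⟨b, hb⟩ := Finite.exists_max G
  obtain ⟨a, rfl⟩ := hsurj a
  obtain ⟨b, rfl⟩ := hsurj b
  exact ⟨a, b, fun x => ha _, fun x => hb _⟩

lemma FinDep.integrable {i : ℤ} {F : (ℤ → Bool) → ℝ} (h : FinDep i F)
    (μ : Measure (ℤ → Bool)) [IsFiniteMeasure μ] : Integrable F μ := by
  obtain ⟨a, b, ha, hb⟩ := h.exists_bound
  exact Integrable.of_mem_Icc (F a) (F b) h.measurable.aemeasurable
    (.of_forall fun x => ⟨ha x, hb x⟩)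

lemma FinDep.chainExp {l : ℕ} (hgd : ∀ i, DependsOn (g i) (Set.Icc (i - (l : ℤ)) (i - 1)))
    {m : ℕ} {j : ℤ} {F : (ℤ → Bool) → ℝ} (h : FinDep (j + m) F) :
    FinDep j (chainExp g m j F) := by
  obtain ⟨s, hs⟩ := h
  exact ⟨_, dependsOn_chainExp hgd m j hs⟩

lemma integral_chainExp {N l : ℕ} {μ : Measure (ℤ → Bool)}
    (hgd : ∀ i, DependsOn (g i) (Set.Icc (i - (l : ℤ)) (i - 1)))
    (hstep : ∀ i : ℤ, 1 ≤ i → i ≤ N → ∀ F, FinDep i F → ∫ b, F b ∂μ = ∫ b, stepOp g i F b ∂μ)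
    (m : ℕ) {j : ℤ} (hj : 0 ≤ j) (hjm : j + m ≤ N) {F : (ℤ → Bool) → ℝ} (hF : FinDep (j + m) F) :
    ∫ b, F b ∂μ = ∫ b, chainExp g m j F b ∂μ := by
  induction m generalizing j with
  | zero => rfl
  | succ m ih =>
    have hF' : FinDep (j + 1 + (m : ℤ)) F := hF.mono (by push_cast; lia)
    rw [chainExp_succ, ← hstep (j + 1) (by lia) (by push_cast at hjm; lia) _ (hF'.chainExp hgd)]
    exact ih (by lia) (by push_cast at hjm; lia) hF'

lemma coord_mem_Icc (r : ℤ) (b : ℤ → Bool) : coord r b ∈ Set.Icc (0 : ℝ) 1 := by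
  unfold coord; split_ifs <;> simp

/-! ### Decay of the influence of the past. -/

section Oscillation

variable (hg0 : ∀ i b, 0 ≤ g i b) (hg1 : ∀ i b, g i b ≤ 1)
include hg0 hg1

lemma chainExp_mem_Icc (m : ℕ) (j : ℤ) {F : (ℤ → Bool) → ℝ} {u v : ℝ}
    (hF : ∀ b, F b ∈ Set.Icc u v) (b : ℤ → Bool) : chainExp g m j F b ∈ Set.Icc u v := by
  constructor
  · have := chainExp_mono hg0 hg1 m j (F := fun _ => u) (G := F) (fun b => (hF b).1) b
    rwa [chainExp_const] at this
  · have := chainExp_mono hg0 hg1 m j (F := F) (G := fun _ => v) (fun b => (hF b).2) b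
    rwa [chainExp_const] at this

/-- Doeblin's argument. Let `δ = max F - min F`. Then `F` is at most `max F - δ` times the indicator
of the minimizing state, and at least `min F + δ` times that of the maximizing state. Each indicator
has conditional expectation at least `α` from any past, so the oscillation falls to `(1 - 2α) δ`. -/
lemma chainExp_contraction {l : ℕ} {j : ℤ} {α M : ℝ} (hα : α ≤ 1 / 2)
    (hpos : ∀ (a : Fin l → Bool) b,
      α ≤ chainExp g l j ({B | state l (j + l) B = a}.indicator fun _ => 1) b)
    {F : (ℤ → Bool) → ℝ} (hF : DependsOn F (Set.Icc (j + 1) (j + l)))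
    (hM : ∀ x y, F x - F y ≤ M) (x y : ℤ → Bool) :
    chainExp g l j F x - chainExp g l j F y ≤ (1 - 2 * α) * M := by
  obtain ⟨a, b, ha, hb⟩ := FinDep.exists_bound ⟨_, hF⟩
  have hst (u v : ℤ → Bool) (h : state l (j + l) u = state l (j + l) v) : F u = F v := by
    refine hF fun i hi => ?_
    have := congrFun h ⟨(j + l - i).toNat, by simp at hi; lia⟩
    simp only [state] at this
    convert this using 2 <;> simp at hi <;> lia
  set δ := F b - F a with hδ
  have hδ0 : 0 ≤ δ := sub_nonneg.2 (ha b)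
  have key (c : ℤ → Bool) (s t : ℝ) : chainExp g l j ((fun _ => s) +
      t • {B | state l (j + l) B = state l (j + l) c}.indicator fun _ => (1 : ℝ)) =
      (fun _ => s) + t • chainExp g l j
        ({B | state l (j + l) B = state l (j + l) c}.indicator fun _ => (1 : ℝ)) := by
    rw [map_add, map_smul, chainExp_const]
  have h1 : F ≤ (fun _ => F b) +
      (-δ) • {B | state l (j + l) B = state l (j + l) a}.indicator fun _ => (1 : ℝ) := by
    intro z
    by_cases hz : state l (j + l) z = state l (j + l) a
    · simp [Set.indicator, hz, hst _ _ hz, hδ]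
    · simpa [Set.indicator, hz] using hb z
  have h2 : (fun _ => F a) +
      δ • ({B | state l (j + l) B = state l (j + l) b}.indicator fun _ => (1 : ℝ)) ≤ F := by
    intro z
    by_cases hz : state l (j + l) z = state l (j + l) b
    · simp [Set.indicator, hz, hst _ _ hz, hδ]
    · simpa [Set.indicator, hz] using ha z
  have h1' := chainExp_mono hg0 hg1 l j h1 x
  have h2' := chainExp_mono hg0 hg1 l j h2 y
  rw [key] at h1' h2'
  simp only [Pi.add_apply, Pi.smul_apply, smul_eq_mul] at h1' h2'
  have h3 := mul_le_mul_of_nonneg_left (hpos (state l (j + l) a) x) hδ0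
  have h4 := mul_le_mul_of_nonneg_left (hpos (state l (j + l) b) y) hδ0
  have h5 := mul_le_mul_of_nonneg_left (hM b a) (by linarith : 0 ≤ 1 - 2 * α)
  rw [← hδ] at h5
  linarith

lemma chainExp_coord_sub_le {N l : ℕ} (hl : 1 ≤ l) {α : ℝ} (hα : α ≤ 1 / 2)
    (hgd : ∀ i, DependsOn (g i) (Set.Icc (i - (l : ℤ)) (i - 1)))
    (hpos : ∀ j : ℤ, 1 ≤ j → j + l ≤ N → ∀ (a : Fin l → Bool) b,
      α ≤ chainExp g l j ({B | state l (j + l) B = a}.indicator fun _ => 1) b)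
    (m : ℕ) {j : ℤ} (hj : 1 ≤ j) (hjm : j + m ≤ N) (x y : ℤ → Bool) :
    chainExp g m j (coord (j + m)) x - chainExp g m j (coord (j + m)) y
      ≤ (1 - 2 * α) ^ (m / l) := by
  induction m using Nat.strong_induction_on generalizing j x y with
  | _ m ih =>
    -- Below one full memory length only the trivial oscillation bound `1` is used; otherwise the
    -- first `l` steps contribute one factor `1 - 2α`.
    by_cases hml : m < l
    · rw [Nat.div_eq_of_lt hml, pow_zero]
      have h1 := chainExp_mem_Icc hg0 hg1 m j (coord_mem_Icc (j + m)) x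
      have h2 := chainExp_mem_Icc hg0 hg1 m j (coord_mem_Icc (j + m)) y
      linarith [h1.2, h2.1]
    · push Not at hml
      obtain ⟨q, rfl⟩ := Nat.exists_eq_add_of_le hml
      have e : j + ((l + q : ℕ) : ℤ) = j + l + q := by push_cast; ring
      have hdiv : (l + q) / l = q / l + 1 := by
        rw [Nat.add_comm, Nat.add_div_right _ hl]
      rw [chainExp_add, e, hdiv, pow_succ']
      refine chainExp_contraction hg0 hg1 hα (hpos j hj (by push_cast at hjm; lia)) ?_
        (fun u v => ih q (by lia) (by lia) (by push_cast at hjm; lia) u v) x y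
      refine (dependsOn_chainExp (s := j + l + q) hgd q (j + l)
        ((dependsOn_coord _).mono (by simp))).mono ?_
      intro z hz; simp at *; lia

end Oscillation

/-! ### Hoeffding's lemma, Schur's test and geometric weights. -/

/-- Hoeffding's lemma for the law with mass `p` at `x` and `1 - p` at `y`. -/
lemma two_point_exp_le {p : ℝ} (hp0 : 0 ≤ p) (hp1 : p ≤ 1) (x y : ℝ) :
    p * Real.exp x + (1 - p) * Real.exp y
      ≤ Real.exp (p * x + (1 - p) * y + (x - y) ^ 2 / 8) := by
  let ν : Measure ℝ := ENNReal.ofReal p • Measure.dirac x + ENNReal.ofReal (1 - p) • Measure.dirac y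
  have hν : IsProbabilityMeasure ν := ⟨by
    simp [ν, ← ENNReal.ofReal_add hp0 (sub_nonneg.2 hp1)]⟩
  have hint (f : ℝ → ℝ) : ∫ t, f t ∂ν = p * f x + (1 - p) * f y := by
    rw [integral_add_measure, integral_smul_measure, integral_smul_measure, integral_dirac,
      integral_dirac, ENNReal.toReal_ofReal hp0, ENNReal.toReal_ofReal (sub_nonneg.2 hp1)]
    · rfl
    · exact (integrable_dirac (by simp)).smul_measure (by simp)
    · exact (integrable_dirac (by simp)).smul_measure (by simp)
  have hb : ∀ᵐ t ∂ν, id t ∈ Set.Icc (min x y) (max x y) := by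
    rw [ae_add_measure_iff]
    exact ⟨Measure.ae_smul_measure (by simp [ae_dirac_eq]) _,
      Measure.ae_smul_measure (by simp [ae_dirac_eq]) _⟩
  have h := (hasSubgaussianMGF_of_mem_Icc (μ := ν) measurable_id.aemeasurable hb).mgf_le 1
  rw [mgf, hint, hint] at h
  have hn : (‖max x y - min x y‖ / 2) ^ 2 * 1 ^ 2 / 2 = (x - y) ^ 2 / 8 := by
    rw [max_sub_min_eq_abs, Real.norm_eq_abs, abs_abs, div_pow, sq_abs]; ring
  push_cast at h
  rw [hn] at h
  simp only [id, one_mul] at h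
  rw [Real.exp_sub, Real.exp_sub, ← mul_div_assoc, ← mul_div_assoc, ← add_div,
    div_le_iff₀ (Real.exp_pos _), ← Real.exp_add] at h
  rwa [add_comm (p * x + (1 - p) * y)]

/-- Schur's test: Cauchy–Schwarz with weight `w i r` uses the row sums, and exchanging the sums uses
the column sums. -/
lemma sum_sq_sum_mul_le {ι κ : Type*} (s : Finset ι) (t : Finset κ) (w : ι → κ → ℝ) (c : κ → ℝ)
    {H : ℝ} (hw : ∀ i r, 0 ≤ w i r) (hrow : ∀ i ∈ s, ∑ r ∈ t, w i r ≤ H)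
    (hcol : ∀ r ∈ t, ∑ i ∈ s, w i r ≤ H) (hH : 0 ≤ H) :
    ∑ i ∈ s, (∑ r ∈ t, |c r| * w i r) ^ 2 ≤ H ^ 2 * ∑ r ∈ t, c r ^ 2 := by
  calc ∑ i ∈ s, (∑ r ∈ t, |c r| * w i r) ^ 2
      ≤ ∑ i ∈ s, H * ∑ r ∈ t, c r ^ 2 * w i r := by
        refine Finset.sum_le_sum fun i hi => ?_
        refine (Finset.sum_sq_le_sum_mul_sum_of_sq_le_mul t (f := w i)
          (g := fun r => c r ^ 2 * w i r) (fun r _ => hw i r)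
          (fun r _ => mul_nonneg (sq_nonneg _) (hw i r)) (fun r _ => ?_)).trans ?_
        · rw [mul_pow, sq_abs]; exact le_of_eq (by ring)
        · exact mul_le_mul_of_nonneg_right (hrow i hi)
            (Finset.sum_nonneg fun r _ => mul_nonneg (sq_nonneg _) (hw i r))
    _ = H * ∑ r ∈ t, c r ^ 2 * ∑ i ∈ s, w i r := by
        rw [← Finset.mul_sum, Finset.sum_comm]
        simp_rw [Finset.mul_sum]
    _ ≤ H * ∑ r ∈ t, c r ^ 2 * H := by
        gcongr with r hr
        exact hcol r hr
    _ = H ^ 2 * ∑ r ∈ t, c r ^ 2 := by rw [← Finset.sum_mul]; ring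

/-- The Toeplitz weight `η (r - i)` for `i ≤ r`, and `0` otherwise. -/
def toeplitz (η : ℕ → ℝ) (i r : ℕ) : ℝ := if i ≤ r then η (r - i) else 0

lemma toeplitz_nonneg {η : ℕ → ℝ} (hη : ∀ m, 0 ≤ η m) (i r : ℕ) : 0 ≤ toeplitz η i r := by
  unfold toeplitz; split_ifs <;> simp [hη]

lemma sum_sq_toeplitz_le {η : ℕ → ℝ} (hη : ∀ m, 0 ≤ η m) {H : ℝ}
    (hH : ∀ M, ∑ m ∈ Finset.range M, η m ≤ H) (N : ℕ) (c : ℕ → ℝ) :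
    ∑ i ∈ Finset.range N, (∑ r ∈ Finset.range N, |c r| * toeplitz η i r) ^ 2
      ≤ H ^ 2 * ∑ r ∈ Finset.range N, c r ^ 2 := by
  refine sum_sq_sum_mul_le _ _ _ _ (toeplitz_nonneg hη) (fun i hi => ?_) (fun r hr => ?_)
    (by simpa using hH 0)
  · refine le_trans (le_of_eq ?_) (hH (N - i))
    unfold toeplitz
    rw [← Finset.sum_filter, Finset.range_eq_Ico, Finset.range_eq_Ico]
    have : Finset.filter (fun r => i ≤ r) (Finset.Ico 0 N) = Finset.Ico i N := by
      ext r; simp [and_comm]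
    rw [this, Finset.sum_Ico_eq_sum_range, Finset.range_eq_Ico]
    simp
  · refine le_trans (le_of_eq ?_) (hH (r + 1))
    unfold toeplitz
    rw [← Finset.sum_filter, ← Finset.sum_range_reflect]
    refine Finset.sum_congr ?_ fun i hi => by simp
    ext i; simp at *; lia

lemma sum_pow_div_le {ρ : ℝ} (h0 : 0 ≤ ρ) (h1 : ρ < 1) {l : ℕ} (hl : 1 ≤ l) (M : ℕ) :
    ∑ m ∈ Finset.range M, ρ ^ (m / l) ≤ l / (1 - ρ) := by
  have h (K : ℕ) : ∑ m ∈ Finset.range (l * K), ρ ^ (m / l) = l * ∑ q ∈ Finset.range K, ρ ^ q := by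
    induction K with
    | zero => simp
    | succ K ih =>
      rw [Nat.mul_succ, Finset.sum_range_add, ih, Finset.sum_range_succ, mul_add]
      congr 1
      rw [Finset.sum_congr rfl (g := fun _ => ρ ^ K) fun x hx => ?_]
      · simp
      · rw [Nat.mul_add_div hl, Nat.div_eq_of_lt (by simpa using hx), add_zero]
  calc ∑ m ∈ Finset.range M, ρ ^ (m / l) ≤ ∑ m ∈ Finset.range (l * M), ρ ^ (m / l) :=
        Finset.sum_le_sum_of_subset_of_nonneg
          (Finset.range_subset_range.2 (Nat.le_mul_of_pos_left _ hl)) fun _ _ _ => by positivity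
    _ = l * ∑ q ∈ Finset.range M, ρ ^ q := h M
    _ ≤ l * (1 - ρ)⁻¹ := by
        gcongr
        rw [← tsum_geometric_of_lt_one h0 h1]
        exact (summable_geometric_of_lt_one h0 h1).sum_le_tsum _ fun _ _ => by positivity
    _ = l / (1 - ρ) := rfl

/-! ### Martingale bound for linear statistics. -/

/-- The linear statistic `∑ c_r B_{r+1}`. -/
def linStat (N : ℕ) (c : ℕ → ℝ) : (ℤ → Bool) → ℝ :=
  ∑ r ∈ Finset.range N, c r • coord ((r : ℤ) + 1)

lemma finDep_linStat (N : ℕ) (c : ℕ → ℝ) : FinDep N (linStat N c) :=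
  FinDep.sum _ fun r hr => (finDep_coord (by simp at hr; lia)).comp (c r • ·)

/-- This is the range of the martingale increment when `B_{i+1}` is revealed. Variables before it
are fixed and cancel; a later `B_{r+1}` contributes its oscillation over `r - i` steps. -/
lemma abs_chainExp_linStat_sub_le {N : ℕ} {η : ℕ → ℝ}
    (hosc : ∀ (j : ℤ) (m : ℕ), 1 ≤ j → j + m ≤ N → ∀ x y,
      chainExp g m j (coord (j + m)) x - chainExp g m j (coord (j + m)) y ≤ η m)
    (c : ℕ → ℝ) {m i : ℕ} (hmi : i + 1 + m = N) {x y : ℤ → Bool}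
    (hxy : ∀ j : ℤ, j < i + 1 → x j = y j) :
    |chainExp g m ((i : ℤ) + 1) (linStat N c) x - chainExp g m ((i : ℤ) + 1) (linStat N c) y|
      ≤ ∑ r ∈ Finset.range N, |c r| * toeplitz η i r := by
  unfold linStat
  rw [map_sum]
  simp only [map_smul, Finset.sum_apply, Pi.smul_apply, smul_eq_mul]
  rw [← Finset.sum_sub_distrib]
  refine (Finset.abs_sum_le_sum_abs _ _).trans (Finset.sum_le_sum fun r hr => ?_)
  rw [← mul_sub, abs_mul]
  refine mul_le_mul_of_nonneg_left ?_ (abs_nonneg _)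
  have hr := Finset.mem_range.1 hr
  unfold toeplitz
  split_ifs with hir
  · obtain ⟨q, rfl⟩ := Nat.exists_eq_add_of_le hir
    obtain ⟨s, rfl⟩ : ∃ s, m = q + s := ⟨m - q, by lia⟩
    have e : ((i + q : ℕ) : ℤ) + 1 = i + 1 + q := by push_cast; ring
    rw [chainExp_add, e, chainExp_of_dependsOn s _ ((dependsOn_coord _).mono (by simp)),
      Nat.add_sub_cancel_left]
    have h := hosc (i + 1) q (by lia) (by lia)
    exact abs_sub_le_iff.2 ⟨h x y, h y x⟩
  · rw [chainExp_of_dependsOn m _ ((dependsOn_coord _).mono (by simp only [Set.singleton_subset_iff, Set.mem_Iic]; lia))]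
    rw [dependsOn_coord _ (x := x) (y := y) fun j hj => hxy j (by simp at hj; lia)]
    simp

/-- Azuma–Hoeffding, run backwards in time: integrating out `B_{i+1}` costs one Hoeffding factor,
and the mean of the two outcomes is the martingale at time `i`. -/
lemma integral_exp_linStat_le {N l : ℕ} {μ : Measure (ℤ → Bool)} [IsProbabilityMeasure μ]
    (hg0 : ∀ i b, 0 ≤ g i b) (hg1 : ∀ i b, g i b ≤ 1)
    (hgd : ∀ i, DependsOn (g i) (Set.Icc (i - (l : ℤ)) (i - 1)))
    (hstep : ∀ i : ℤ, 1 ≤ i → i ≤ N → ∀ F, FinDep i F → ∫ b, F b ∂μ = ∫ b, stepOp g i F b ∂μ)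
    {η : ℕ → ℝ}
    (hosc : ∀ (j : ℤ) (m : ℕ), 1 ≤ j → j + m ≤ N → ∀ x y,
      chainExp g m j (coord (j + m)) x - chainExp g m j (coord (j + m)) y ≤ η m)
    (c : ℕ → ℝ) (m i : ℕ) (hmi : i + m = N) :
    ∫ b, Real.exp (linStat N c b) ∂μ ≤
      Real.exp (∑ t ∈ Finset.Ico i N, (∑ r ∈ Finset.range N, |c r| * toeplitz η t r) ^ 2 / 8) *
        ∫ b, Real.exp (chainExp g m i (linStat N c) b) ∂μ := by
  induction m generalizing i with
  | zero =>
    obtain rfl : i = N := by lia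
    simp
  | succ m ih =>
    refine (ih (i + 1) (by lia)).trans ?_
    rw [← Finset.sum_Ioo_add_eq_sum_Ico (by lia : i < N), Real.exp_add, mul_assoc]
    have hI : Finset.Ioo i N = Finset.Ico (i + 1) N := by ext; simp
    rw [hI]
    refine mul_le_mul_of_nonneg_left ?_ (Real.exp_nonneg _)
    rw [chainExp_succ]
    push_cast
    set G := chainExp g m ((i : ℤ) + 1) (linStat N c) with hG
    have hGd : FinDep ((i : ℤ) + 1) G := ((finDep_linStat N c).mono (by lia)).chainExp hgd
    rw [hstep (i + 1) (by lia) (by lia) _ (hGd.comp Real.exp), ← integral_const_mul]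
    have hS : FinDep (i : ℤ) (stepOp g ((i : ℤ) + 1) G) := by
      rw [hG, ← chainExp_succ]
      exact ((finDep_linStat N c).mono (by push_cast; lia)).chainExp hgd
    have hE : FinDep (i : ℤ) (stepOp g ((i : ℤ) + 1) fun b => Real.exp (G b)) := by
      obtain ⟨s, hs⟩ := hGd.comp Real.exp
      exact ⟨min s (i + 1 - l), (dependsOn_stepOp hgd hs).mono (by simp)⟩
    refine integral_mono (hE.integrable μ) ((hS.comp Real.exp).integrable μ |>.const_mul _)
      fun b => ?_
    simp only [stepOp_apply]
    refine (two_point_exp_le (hg0 _ b) (hg1 _ b) _ _).trans ?_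
    rw [add_comm, Real.exp_add]
    refine mul_le_mul_of_nonneg_right (Real.exp_le_exp.2 ?_) (Real.exp_nonneg _)
    refine div_le_div_of_nonneg_right ?_ (by norm_num)
    rw [← sq_abs]
    refine pow_le_pow_left₀ (abs_nonneg _) (abs_chainExp_linStat_sub_le hosc c (by lia) ?_) 2
    intro j hj
    rw [Function.update_of_ne (by lia), Function.update_of_ne (by lia)]

end ChainExp

/-! ### The operators for the actual chain. -/

/-- The conditional probability of `B_i = 1` given the last `l` values. -/
noncomputable def condProb (μ : Measure (ℤ → Bool)) (l : ℕ) (i : ℤ) (b : ℤ → Bool) : ℝ :=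
  (μ[|pastEvent l i b]).real {B | B i = true}

section CondProb
variable (μ : Measure (ℤ → Bool)) (l : ℕ)

lemma condProb_nonneg (i : ℤ) (b : ℤ → Bool) : 0 ≤ condProb μ l i b := measureReal_nonneg

/-- On a null past the conditional measure is zero, so the bounds hold for every `b` and not only
almost surely. -/
lemma condProb_le_one (i : ℤ) (b : ℤ → Bool) : condProb μ l i b ≤ 1 := measureReal_le_one

lemma pastEvent_congr {m : ℕ} {i : ℤ} {x y : ℤ → Bool}
    (h : ∀ j ∈ Set.Icc (i - (m : ℤ)) (i - 1), x j = y j) : pastEvent m i x = pastEvent m i y := by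
  ext B
  refine forall_congr' fun j => forall₂_congr fun h1 h2 => ?_
  rw [h j ⟨h1, by lia⟩]

lemma dependsOn_condProb (i : ℤ) :
    DependsOn (condProb μ l i) (Set.Icc (i - (l : ℤ)) (i - 1)) := by
  intro x y h
  simp only [condProb, pastEvent_congr h]

end CondProb

lemma measurableSet_pastEvent (m : ℕ) (i : ℤ) (b : ℤ → Bool) : MeasurableSet (pastEvent m i b) := by
  have : pastEvent m i b = ⋂ j : ℤ, ⋂ (_ : i - (m : ℤ) ≤ j), ⋂ (_ : j < i),
      (fun B : ℤ → Bool => B j) ⁻¹' {b j} := by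
    ext B; simp [pastEvent]
  rw [this]
  exact .iInter fun j => .iInter fun _ => .iInter fun _ =>
    measurable_pi_apply j (measurableSet_singleton _)

lemma measurableSet_coord (i : ℤ) : MeasurableSet {B : ℤ → Bool | B i = true} := by
  have : {B : ℤ → Bool | B i = true} = (fun B => B i) ⁻¹' {true} := by ext; simp
  rw [this]
  exact measurable_pi_apply i (measurableSet_singleton true)

lemma integral_coord (μ : Measure (ℤ → Bool)) (i : ℤ) :
    ∫ B, coord i B ∂μ = μ.real {B | B i = true} := by
  rw [← integral_indicator_one (measurableSet_coord i)]
  congr 1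
  ext B
  simp [coord, Set.indicator]

lemma measureReal_cond_mul {Ω : Type*} [MeasurableSpace Ω] {μ : Measure Ω} [IsFiniteMeasure μ]
    {s : Set Ω} (hs : MeasurableSet s) (t : Set Ω) :
    (μ[|s]).real t * μ.real s = μ.real (s ∩ t) := by
  rw [measureReal_def, measureReal_def, ← ENNReal.toReal_mul, cond_mul_eq_inter hs]
  rfl

/-- The sequence that agrees with `w` on `s` and is `false` elsewhere. -/
def extend (s : Set ℤ) [DecidablePred (· ∈ s)] (w : s → Bool) : ℤ → Bool :=
  fun j => if h : j ∈ s then w ⟨j, h⟩ else false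

lemma extend_restrict (s : Set ℤ) [DecidablePred (· ∈ s)] (B : ℤ → Bool) {j : ℤ} (h : j ∈ s) :
    extend s (s.domRestrict B) j = B j := by
  simp [extend, h]

lemma measurable_extend (s : Set ℤ) [DecidablePred (· ∈ s)] : Measurable (extend s) := by
  refine measurable_pi_lambda _ fun j => ?_
  by_cases h : j ∈ s
  · simpa [extend, h] using measurable_pi_apply _
  · simp [extend, h]

/-- The martingale difference property. The integral splits over the finitely many pasts of length
`m`; on each one the Markov property replaces the conditional probability given `m` values by the
one given `l`. -/
lemma integral_coord_sub_condProb_mul {N l : ℕ} {μ : Measure (ℤ → Bool)} [IsProbabilityMeasure μ]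
    (hμ : IsMarkovOfOrder N l μ) {i : ℤ} (h1 : 1 ≤ i) (hN : i ≤ N) {m : ℕ} (hm : l ≤ m)
    {Φ : (ℤ → Bool) → ℝ} (hΦ : DependsOn Φ (Set.Icc (i - (m : ℤ)) (i - 1))) :
    ∫ B, (coord i B - condProb μ l i B) * Φ B ∂μ = 0 := by
  classical
  set s := Set.Icc (i - (m : ℤ)) (i - 1) with hs
  have key (B : ℤ → Bool) : (coord i B - condProb μ l i B) * Φ B =
      ∑ w : s → Bool, (pastEvent m i (extend s w)).indicator
        (fun B => (coord i B - condProb μ l i (extend s w)) * Φ (extend s w)) B := by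
    have hB (j : ℤ) (hj : j ∈ s) : B j = extend s (s.domRestrict B) j :=
      (extend_restrict s B hj).symm
    rw [Finset.sum_eq_single (s.domRestrict B)]
    · rw [Set.indicator_of_mem, hΦ hB, dependsOn_condProb μ l i fun j hj => hB j ?_]
      · simp [hs] at *; lia
      · intro j hj hj'
        exact hB j ⟨hj, by lia⟩
    · intro w _ hw
      refine Set.indicator_of_notMem (fun hmem => hw ?_) _
      ext ⟨j, hj⟩
      have := hmem j hj.1 (by have := hj.2; lia)
      simp only [Set.domRestrict, this, extend, hj, dif_pos]
    · simp
  simp_rw [key]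
  rw [integral_finsetSum]
  · refine Finset.sum_eq_zero fun w _ => ?_
    set b := extend s w
    have hms := measurableSet_pastEvent m i b
    rw [integral_indicator hms, integral_mul_const,
      integral_sub (((finDep_coord le_rfl).integrable μ).integrableOn)
        (integrable_const _)]
    have e1 : ∫ B in pastEvent m i b, coord i B ∂μ = μ.real (pastEvent m i b ∩ {B | B i = true}) := by
      rw [integral_coord, measureReal_restrict_apply (measurableSet_coord i), Set.inter_comm]
    rw [e1, setIntegral_const, ← measureReal_cond_mul hms, smul_eq_mul]
    by_cases h0 : μ (pastEvent m i b) = 0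
    · simp [measureReal_def, h0]
    · have := hμ i h1 hN m hm b h0
      rw [condProb, measureReal_def (μ := μ[|pastEvent m i b]), this, ← measureReal_def]
      ring
  · intro w _
    refine Integrable.indicator ?_ (measurableSet_pastEvent m i _)
    exact (((finDep_coord le_rfl).integrable μ).sub (integrable_const _)).mul_const _

lemma integral_stepOp {N l : ℕ} {μ : Measure (ℤ → Bool)} [IsProbabilityMeasure μ]
    (hμ : IsMarkovOfOrder N l μ) {i : ℤ} (h1 : 1 ≤ i) (hN : i ≤ N)
    {F : (ℤ → Bool) → ℝ} (hF : FinDep i F) :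
    ∫ b, F b ∂μ = ∫ b, stepOp (condProb μ l) i F b ∂μ := by
  obtain ⟨s, hs⟩ := hF
  -- The past must cover both the memory and the variables on which `F` depends.
  set m := max l (i - s).toNat with hm
  have hs' : DependsOn F (Set.Icc (i - (m : ℤ)) i) :=
    hs.mono (Set.Icc_subset_Icc (by lia) le_rfl)
  have hu (t : Bool) : DependsOn (fun b => F (Function.update b i t))
      (Set.Icc (i - (m : ℤ)) (i - 1)) := by
    intro x y h
    refine hs' fun j hj => ?_
    by_cases hji : j = i
    · subst hji; simp
    · rw [Function.update_of_ne hji, Function.update_of_ne hji]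
      exact h j (by simp at *; lia)
  have hΦ : DependsOn (fun b => F (Function.update b i true) - F (Function.update b i false))
      (Set.Icc (i - (m : ℤ)) (i - 1)) := by
    intro x y h
    have h1 := hu true h
    have h2 := hu false h
    simp only at h1 h2
    simp only [h1, h2]
  have key := integral_coord_sub_condProb_mul hμ h1 hN (m := m) (le_max_left _ _) hΦ
  have hFS : FinDep i (stepOp (condProb μ l) i F) :=
    ⟨_, (dependsOn_stepOp (dependsOn_condProb μ l) hs').mono
      (Set.Icc_subset_Icc_right (by lia))⟩
  rw [← sub_eq_zero, ← integral_sub (FinDep.integrable ⟨s, hs⟩ μ) (hFS.integrable μ), ← key]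
  congr 1
  ext b
  -- Since `B_i` is binary, `F - stepOp F` equals `B_i - condProb` times a function of the past.
  have hb : F b = coord i b * F (Function.update b i true)
      + (1 - coord i b) * F (Function.update b i false) := by
    cases h : b i
    · have : Function.update b i false = b := by rw [← h, Function.update_eq_self]
      simp [coord, h, this]
    · have : Function.update b i true = b := by rw [← h, Function.update_eq_self]
      simp [coord, h, this]
  rw [stepOp_apply, hb]
  ring

lemma measurable_state (l : ℕ) (i : ℤ) : Measurable (state l i) :=
  measurable_pi_lambda _ fun _ => measurable_pi_apply _

lemma measurableSet_state (l : ℕ) (i : ℤ) (a : Fin l → Bool) :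
    MeasurableSet {B | state l i B = a} :=
  measurable_state l i (measurableSet_singleton a)

lemma dependsOn_state_indicator (l : ℕ) (i : ℤ) (a : Fin l → Bool) :
    DependsOn ({B | state l i B = a}.indicator fun _ => (1 : ℝ)) (Set.Icc (i + 1 - l) i) := by
  intro x y h
  have : state l i x = state l i y := by
    ext r
    exact h _ (by have := r.2; simp; lia)
  simp only [Set.indicator, Set.mem_ofPred_eq, this]

/-- The operator value depends on `b` only through the state at time `j`, so it is constant on `T`
and must equal the conditional probability in `HasTransitionBound`. -/
lemma le_chainExp_state_indicator {N l : ℕ} {α : ℝ} {μ : Measure (ℤ → Bool)}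
    [IsProbabilityMeasure μ] (hα : 0 < α) (hM : IsMarkovOfOrder N l μ)
    (hT : HasTransitionBound N l α μ) (hl : 1 ≤ l) {j : ℤ} (hj : 1 ≤ j) (hjl : j + l ≤ N)
    (a : Fin l → Bool) (b : ℤ → Bool) :
    α ≤ chainExp (condProb μ l) l j ({B | state l (j + l) B = a}.indicator fun _ => 1) b := by
  set F : (ℤ → Bool) → ℝ := {B | state l (j + l) B = a}.indicator fun _ => 1 with hF
  set T := {B | state l j B = state l j b} with hTdef
  have hTm : MeasurableSet T := measurableSet_state l j _
  have hFd : DependsOn F (Set.Icc (j + 1) (j + l)) :=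
    (dependsOn_state_indicator l (j + l) a).mono (Set.Icc_subset_Icc (by lia) le_rfl)
  have hΦd : DependsOn (T.indicator fun _ => (1 : ℝ)) (Set.Icc (j + 1 - l) j) :=
    dependsOn_state_indicator l j _
  have h := hT (j + l) (by lia) hjl a (state l j b)
  rw [show j + (l : ℤ) - l = j by ring] at h
  have hGd := dependsOn_chainExp (dependsOn_condProb μ l) l j hFd
  have hint : μ.real (T ∩ {B | state l (j + l) B = a}) =
      chainExp (condProb μ l) l j F b * μ.real T := by
    have hprod : FinDep (j + l) (T.indicator (fun _ => (1 : ℝ)) * F) :=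
      (FinDep.mono (by lia) ⟨_, hΦd⟩).comp₂ ⟨_, hFd⟩ (· * ·)
    have e1 := integral_chainExp (dependsOn_condProb μ l)
      (fun i h1 hN F hF => integral_stepOp hM h1 hN hF) l (by lia : 0 ≤ j) hjl hprod
    rw [chainExp_mul_left l j (hΦd.mono fun x hx => hx.2)] at e1
    have e2 : T.indicator (fun _ => (1 : ℝ)) * F =
        (T ∩ {B | state l (j + l) B = a}).indicator 1 := by
      ext B; simp only [hF, Pi.mul_apply, Set.indicator, Set.mem_inter_iff]; split_ifs <;> simp_all
    have e3 : T.indicator (fun _ => (1 : ℝ)) * chainExp (condProb μ l) l j F =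
        T.indicator fun _ => chainExp (condProb μ l) l j F b := by
      ext B
      by_cases hB : B ∈ T
      · simp only [Pi.mul_apply, Set.indicator_of_mem hB, one_mul]
        refine hGd fun i hi => ?_
        have := congrFun hB ⟨(j - i).toNat, by simp at hi; lia⟩
        simp only [state] at this
        convert this using 2 <;> simp at hi <;> lia
      · simp [Set.indicator_of_notMem hB]
    rw [e3, e2, integral_indicator_one (hTm.inter (measurableSet_state l _ a)),
      integral_indicator_const _ hTm, smul_eq_mul] at e1
    rw [e1, mul_comm]
  rw [← measureReal_cond_mul hTm] at hint
  -- Conditioning on a null event gives the zero measure, which would contradict `0 < α`; hence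
  -- every state has positive probability.
  have hT0 : μ.real T ≠ 0 := fun h0 => by
    rw [cond_eq_zero_of_meas_eq_zero ((measureReal_eq_zero_iff).1 h0)] at h
    simp at h
    linarith
  rw [← mul_right_cancel₀ hT0 hint]
  exact h

/-! ### The dependence parameter and sub-Gaussian noise. -/

/-- The `2 ^ l` states share total mass at most one. -/
lemma two_pow_mul_le_one {N l : ℕ} {α : ℝ} {μ : Measure (ℤ → Bool)} (hN : 1 ≤ N)
    (hT : HasTransitionBound N l α μ) : 2 ^ l * α ≤ 1 := by
  set ν := μ[|{B | state l (1 - (l : ℤ)) B = fun _ => false}]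
  have h := Finset.sum_le_sum fun a (_ : a ∈ (Finset.univ : Finset (Fin l → Bool))) =>
    hT 1 le_rfl (by exact_mod_cast hN) a fun _ => false
  rw [Finset.sum_const] at h
  have h2 : ∑ a : Fin l → Bool, ν.real {B | state l 1 B = a} ≤ 1 := by
    have := sum_measureReal_preimage_singleton (μ := ν) (Finset.univ : Finset (Fin l → Bool))
      (f := state l 1) (fun a _ => measurableSet_state l 1 a)
    change ∑ a : Fin l → Bool, ν.real (state l 1 ⁻¹' {a}) ≤ 1
    rw [this]
    exact measureReal_le_one
  simpa using h.trans h2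

lemma integral_linStat (μ : Measure (ℤ → Bool)) [IsFiniteMeasure μ] (N : ℕ) (c : ℕ → ℝ) :
    ∫ B, linStat N c B ∂μ = ∑ r ∈ Finset.range N, c r * μ.real {B | B ((r : ℤ) + 1) = true} := by
  simp only [linStat, Finset.sum_apply, Pi.smul_apply, smul_eq_mul]
  rw [integral_finsetSum _ fun r _ => ((finDep_coord le_rfl).integrable μ).const_mul _]
  simp_rw [integral_const_mul, integral_coord]

/-- Here `G` is the conditional expectation of `S` given the burn-in. It has variance zero: `E[(G -
e) G] = E[(G - e) S]`, which vanishes because `S` is independent of the burn-in and `G - e` is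
centred. -/
lemma integral_exp_chainExp_linStat {N l : ℕ} {μ : Measure (ℤ → Bool)} [IsProbabilityMeasure μ]
    (hB : IsBurnIn N μ) (hM : IsMarkovOfOrder N l μ) (c : ℕ → ℝ) :
    ∫ b, Real.exp (chainExp (condProb μ l) N 0 (linStat N c) b) ∂μ =
      Real.exp (∫ b, linStat N c b ∂μ) := by
  classical
  set S := linStat N c with hS
  set G := chainExp (condProb μ l) N 0 S with hG
  set e := ∫ b, S b ∂μ with he
  have hSd : FinDep ((0 : ℕ) + (N : ℤ)) S := (finDep_linStat N c).mono (by simp)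
  have hgd := dependsOn_condProb μ l
  have hstep := fun (i : ℤ) (h1 : 1 ≤ i) (hN : i ≤ N) F (hF : FinDep i F) =>
    integral_stepOp hM h1 hN hF
  have hGd : FinDep 0 G := hSd.chainExp hgd
  have hGd' : DependsOn G (Set.Iic 0) := hGd.elim fun s hs => hs.mono fun x hx => hx.2
  have hSd' : DependsOn S (Set.Icc (1 : ℤ) N) := by
    intro x y h
    simp only [hS, linStat, Finset.sum_apply, Pi.smul_apply]
    refine Finset.sum_congr rfl fun r hr => ?_
    rw [dependsOn_coord (r + 1 : ℤ) (x := x) (y := y)]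
    intro i hi
    refine h i ?_
    simp at *; lia
  have hGe : FinDep 0 (fun b => G b - e) := hGd.comp (· - e)
  have hind : IndepFun (fun b => G b - e) S μ := by
    have := hB.2.2.comp (φ := fun w => G (extend (Set.Iic 0) w) - e)
      (ψ := fun w => S (extend (Set.Icc 1 (N : ℤ)) w))
      ((hGd.measurable.comp (measurable_extend _)).sub_const e)
      ((finDep_linStat N c).measurable.comp (measurable_extend _))
    convert this using 1
    · ext B
      exact congrArg (· - e) (hGd' fun j hj => (extend_restrict _ B hj).symm)
    · ext B
      exact hSd' fun j hj => (extend_restrict _ B hj).symm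
  have hintG : ∫ b, G b ∂μ = e :=
    (integral_chainExp hgd hstep N le_rfl (by simp) hSd).symm
  have hcenter : ∫ b, (G b - e) ∂μ = 0 := by
    rw [integral_sub (hGd.integrable μ) (integrable_const _), hintG]; simp
  have hcross : ∫ b, (G b - e) * G b ∂μ = 0 := by
    have h1 := hind.integral_fun_mul_eq_mul_integral hGe.measurable.aestronglyMeasurable
      hSd.measurable.aestronglyMeasurable
    rw [hcenter, zero_mul] at h1
    have h2 := integral_chainExp hgd hstep N le_rfl (by simp)
      (F := (fun b => G b - e) * S) ((hGe.mono (by simp)).comp₂ hSd (· * ·))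
    rw [chainExp_mul_left N 0 (fun x y h => congrArg (· - e) (hGd' h))] at h2
    exact h2.symm.trans h1
  have hsq : ∫ b, (G b - e) ^ 2 ∂μ = 0 := by
    have : ∀ b, (G b - e) ^ 2 = (G b - e) * G b - (G b - e) * e := fun b => by ring
    simp_rw [this]
    rw [integral_sub ((hGe.comp₂ hGd (· * ·)).integrable μ) ((hGe.integrable μ).mul_const _),
      hcross, integral_mul_const, hcenter]
    simp
  have hae : (fun b => (G b - e) ^ 2) =ᵐ[μ] 0 :=
    (integral_eq_zero_iff_of_nonneg (fun b => sq_nonneg _)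
      ((hGe.comp (· ^ 2)).integrable μ)).1 hsq
  rw [integral_congr_ae (g := fun _ => Real.exp e)]
  · simp
  · filter_upwards [hae] with b hb
    have : G b - e = 0 := by simpa using hb
    rw [sub_eq_zero.1 this]

lemma chi_nonneg_lt_one {N l : ℕ} {α : ℝ} {μ : Measure (ℤ → Bool)} (hα : 0 < α) (hN : 1 ≤ N)
    (hT : HasTransitionBound N l α μ) : 0 ≤ chi l α ∧ chi l α < 1 := by
  unfold chi
  split_ifs with hl
  · simp
  have h := two_pow_mul_le_one hN hT
  have h2 : (2 : ℝ) ≤ 2 ^ l := le_self_pow₀ (by norm_num) hl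
  have h0 : 0 ≤ 1 - 2 * α := by nlinarith
  exact ⟨Real.rpow_nonneg h0 _,
    Real.rpow_lt_one h0 (by linarith) (by positivity)⟩

/-- The claim amounts to `l (1 - χ) ≤ 4α`. From `2α = 1 - χ ^ l = (1 - χ) ∑ χ ^ i ≥ (1 - χ) l χ ^ l`
it suffices that `χ ^ l = 1 - 2α ≥ 1 / 2`, which holds for `l ≥ 2` because then `α ≤ 1 / 4`. -/
lemma div_two_mul_le_two_div {N l : ℕ} {α : ℝ} {μ : Measure (ℤ → Bool)} (hα : 0 < α) (hN : 1 ≤ N)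
    (hT : HasTransitionBound N l α μ) (hl : 1 ≤ l) : l / (2 * α) ≤ 2 / (1 - chi l α) := by
  obtain ⟨hχ0, hχ1⟩ := chi_nonneg_lt_one hα hN hT
  have h := two_pow_mul_le_one hN hT
  have h2 : (2 : ℝ) ≤ 2 ^ l := le_self_pow₀ (by norm_num) (by lia)
  have h0 : 0 ≤ 1 - 2 * α := by nlinarith
  set χ := chi l α with hχ
  have hpow : χ ^ l = 1 - 2 * α := by
    rw [hχ, chi, if_neg (by lia), ← Real.rpow_natCast, ← Real.rpow_mul h0,
      one_div_mul_cancel (by positivity), Real.rpow_one]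
  rw [div_le_div_iff₀ (by linarith) (by linarith)]
  obtain rfl | hl2 : l = 1 ∨ 2 ≤ l := by lia
  · rw [pow_one] at hpow
    push_cast
    linarith
  · have h4 : (2 : ℝ) ^ 2 ≤ 2 ^ l := pow_le_pow_right₀ (by norm_num) hl2
    have hα4 : 4 * α ≤ 1 := by nlinarith
    have hgeom := geom_sum_mul_neg χ l
    have hlow : (l : ℝ) * χ ^ l ≤ ∑ i ∈ Finset.range l, χ ^ i := by
      rw [← nsmul_eq_mul]
      conv_lhs => rw [← Finset.card_range l]
      exact Finset.card_nsmul_le_sum _ _ _ fun i hi =>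
        pow_le_pow_of_le_one hχ0 hχ1.le (by simpa using (Finset.mem_range.1 hi).le)
    have := mul_le_mul_of_nonneg_right hlow (sub_nonneg.2 hχ1.le)
    rw [hgeom, hpow] at this
    have hl0 : 0 ≤ (l : ℝ) * (1 - χ) := mul_nonneg (by positivity) (sub_nonneg.2 hχ1.le)
    nlinarith

/-- Linear statistics of the edge variables are sub-Gaussian with variance proxy
`‖c‖² / (1 - χ)²`. -/
theorem integral_exp_sum_centered_le {N l : ℕ} {α : ℝ} {μ : Measure (ℤ → Bool)}
    [IsProbabilityMeasure μ] (hα : 0 < α) (hN : 1 ≤ N) (hB : IsBurnIn N μ)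
    (hM : IsMarkovOfOrder N l μ) (hT : HasTransitionBound N l α μ) (c : ℕ → ℝ) :
    ∫ B, Real.exp (∑ r ∈ Finset.range N,
        c r * (coord ((r : ℤ) + 1) B - μ.real {B | B ((r : ℤ) + 1) = true})) ∂μ
      ≤ Real.exp (1 / (1 - chi l α) ^ 2 * (∑ r ∈ Finset.range N, c r ^ 2) / 2) := by
  obtain ⟨hχ0, hχ1⟩ := chi_nonneg_lt_one hα hN hT
  have hg0 := condProb_nonneg μ l
  have hg1 := condProb_le_one μ l
  have hgd := dependsOn_condProb μ l
  have hstep := fun (i : ℤ) (h1 : 1 ≤ i) (hN : i ≤ N) F (hF : FinDep i F) =>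
    integral_stepOp hM h1 hN hF
  obtain ⟨η, hη, hH, hosc⟩ : ∃ η : ℕ → ℝ, (∀ m, 0 ≤ η m) ∧
      (∀ M, ∑ m ∈ Finset.range M, η m ≤ 2 / (1 - chi l α)) ∧
      ∀ (j : ℤ) (m : ℕ), 1 ≤ j → j + m ≤ N → ∀ x y,
        chainExp (condProb μ l) m j (coord (j + m)) x
          - chainExp (condProb μ l) m j (coord (j + m)) y ≤ η m := by
    rcases Nat.eq_zero_or_pos l with rfl | hl
    -- Without memory a variable influences only itself.
    · refine ⟨fun m => if m = 0 then 1 else 0, fun m => by positivity, fun M => ?_, ?_⟩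
      · rw [Finset.sum_ite_eq' (Finset.range M) 0 fun _ => (1 : ℝ)]
        simp only [chi, if_true]
        split_ifs <;> norm_num
      · intro j m _ _ x y
        rcases m with _ | m
        · have h1 := coord_mem_Icc j x
          have h2 := coord_mem_Icc j y
          simp only [chainExp_zero, Nat.cast_zero, add_zero, if_true]
          linarith [h1.2, h2.1]
        · have hd := dependsOn_chainExp (s := j + ((m + 1 : ℕ) : ℤ)) hgd (m + 1) j
            (F := coord (j + ((m + 1 : ℕ) : ℤ))) ((dependsOn_coord _).mono (by simp))
          rw [hd (x := x) (y := y) fun i hi => by simp at hi]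
          simp
    · have h2 : (2 : ℝ) ≤ 2 ^ l := le_self_pow₀ (by norm_num) (by lia)
      have h := two_pow_mul_le_one hN hT
      have hα2 : α ≤ 1 / 2 := by nlinarith
      have h0 : 0 ≤ 1 - 2 * α := by linarith
      refine ⟨fun m => (1 - 2 * α) ^ (m / l), fun m => by positivity, fun M => ?_, ?_⟩
      · refine (sum_pow_div_le h0 (by linarith) hl M).trans ?_
        rw [sub_sub_cancel]
        exact div_two_mul_le_two_div hα hN hT hl
      · intro j m hj hjm x y
        exact chainExp_coord_sub_le hg0 hg1 hl hα2 hgd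
          (fun j hj hjl a b => le_chainExp_state_indicator hα hM hT hl hj hjl a b) m hj hjm x y
  have key := integral_exp_linStat_le (μ := μ) hg0 hg1 hgd hstep hosc c N 0 (zero_add N)
  rw [Nat.cast_zero, integral_exp_chainExp_linStat hB hM, ← Finset.sum_div,
    ← Finset.range_eq_Ico] at key
  have hsum := sum_sq_toeplitz_le hη hH N c
  have hcen (B : ℤ → Bool) : ∑ r ∈ Finset.range N,
      c r * (coord ((r : ℤ) + 1) B - μ.real {B | B ((r : ℤ) + 1) = true}) =
      linStat N c B - ∫ B, linStat N c B ∂μ := by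
    rw [integral_linStat, linStat, Finset.sum_apply, ← Finset.sum_sub_distrib]
    simp only [Pi.smul_apply, smul_eq_mul, mul_sub]
  simp_rw [hcen, Real.exp_sub]
  rw [integral_div, div_le_iff₀ (Real.exp_pos _)]
  refine key.trans (mul_le_mul_of_nonneg_right (Real.exp_le_exp.2 ?_) (Real.exp_nonneg _))
  -- The constants combine as `(2 / (1 - χ))² / 8 = (1 / (1 - χ)²) / 2`.
  refine (div_le_div_of_nonneg_right hsum (by norm_num)).trans (le_of_eq ?_)
  rw [div_pow]
  ring

/-! ### Exponential moments for least squares over block models. -/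

lemma gaussian_linearization {v : ℝ} (hv : 0 < v) (x : ℝ) :
    Integrable (fun t : ℝ => Real.exp (t * x - v * t ^ 2)) ∧
    ∫ t : ℝ, Real.exp (t * x - v * t ^ 2) = √(Real.pi / v) * Real.exp (x ^ 2 / (4 * v)) := by
  have h (t : ℝ) : Real.exp (t * x - v * t ^ 2) =
      Real.exp (-v * (t - x / (2 * v)) ^ 2) * Real.exp (x ^ 2 / (4 * v)) := by
    rw [← Real.exp_add]
    congr 1
    field_simp
    ring
  simp_rw [h]
  refine ⟨((integrable_exp_neg_mul_sq hv).comp_sub_right _).mul_const _, ?_⟩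
  rw [integral_mul_const, integral_sub_right_eq_self (fun t : ℝ => Real.exp (-v * t ^ 2)),
    integral_gaussian]

section Blocks
variable {E K Ω : Type*} [Fintype E] [DecidableEq K] [Fintype Ω]

/-- The sum of `x` over the block `κ`. -/
def blockSum (β : E → K) (x : E → ℝ) (κ : K) : ℝ := ∑ e with β e = κ, x e

lemma sum_comp_mul [Fintype K] (β : E → K) (r : K → ℝ) (x : E → ℝ) :
    ∑ e, r (β e) * x e = ∑ κ, r κ * blockSum β x κ := by
  rw [← Finset.sum_fiberwise (s := Finset.univ) (g := β)]
  refine Finset.sum_congr rfl fun κ _ => ?_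
  rw [blockSum, Finset.mul_sum]
  refine Finset.sum_congr rfl fun e he => ?_
  rw [(Finset.mem_filter.1 he).2]

/-- Jointly sub-Gaussian noise: a bound for the exponential moment of the squared projections on
normalized block indicators and of a linear form orthogonal to them. -/
lemma sum_exp_block_le {p : Ω → ℝ} {X : Ω → E → ℝ} {v : ℝ} (hv : 0 < v)
    (hX : ∀ c : E → ℝ, ∑ ω, p ω * Real.exp (∑ e, c e * X ω e)
      ≤ Real.exp (v * (∑ e, c e ^ 2) / 2))
    (β : E → K) (S : Finset K) (c : E → ℝ) (hc : ∀ κ ∈ S, blockSum β c κ = 0) :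
    ∑ ω, p ω * Real.exp (∑ κ ∈ S, blockSum β (X ω) κ ^ 2 / blockSum β 1 κ / (4 * v)
      + ∑ e, c e * X ω e) ≤ √2 ^ S.card * Real.exp (v * (∑ e, c e ^ 2) / 2) := by
  induction S using Finset.induction_on generalizing c with
  | empty => simpa using hX c
  | insert κ₀ S hκ ih =>
    have hc' : ∀ κ ∈ S, blockSum β c κ = 0 := fun κ h => hc κ (Finset.mem_insert_of_mem h)
    have h2 : (1 : ℝ) ≤ √2 := by
      rw [Real.one_le_sqrt]; norm_num
    simp_rw [Finset.sum_insert hκ]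
    rw [Finset.card_insert_of_notMem hκ]
    have hn0 : 0 ≤ blockSum β (1 : E → ℝ) κ₀ := Finset.sum_nonneg fun _ _ => zero_le_one
    rcases hn0.eq_or_lt with hn | hn
    -- An empty block contributes `0` by the convention for division by zero.
    · simp only [← hn, div_zero, zero_div, zero_add]
      refine (ih c hc').trans ?_
      gcongr
      · lia
    set s := √(blockSum β (1 : E → ℝ) κ₀) with hs
    have hs0 : 0 < s := Real.sqrt_pos.2 hn
    have hs2 : s ^ 2 = blockSum β (1 : E → ℝ) κ₀ := Real.sq_sqrt hn.le
    -- Linearizing the square of block `κ₀` adds `t` times its normalized indicator to the linear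
    -- form. The sum stays orthogonal to the other blocks, so induction applies, and by
    -- orthogonality its squared norm is `‖c‖² + t²`.
    let d (t : ℝ) (e : E) : ℝ := c e + if β e = κ₀ then t / s else 0
    have hd (t : ℝ) : ∀ κ ∈ S, blockSum β (d t) κ = 0 := by
      intro κ hκS
      rw [← hc' κ hκS]
      refine Finset.sum_congr rfl fun e he => ?_
      have : β e ≠ κ₀ := by
        rw [(Finset.mem_filter.1 he).2]
        rintro rfl
        exact hκ hκS
      simp [d, this]
    have hdX (t : ℝ) (x : E → ℝ) :
        ∑ e, d t e * x e = ∑ e, c e * x e + t * (blockSum β x κ₀ / s) := by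
      simp only [d, add_mul, ite_mul, zero_mul, Finset.sum_add_distrib, blockSum,
        Finset.sum_filter, Finset.sum_div, Finset.mul_sum]
      congr 1
      refine Finset.sum_congr rfl fun e _ => ?_
      split_ifs <;> ring
    have hd2 (t : ℝ) : ∑ e, d t e ^ 2 = ∑ e, c e ^ 2 + t ^ 2 := by
      have h1 : ∑ e, d t e ^ 2 = ∑ e, c e ^ 2 + (2 * t / s) * blockSum β c κ₀
          + (t / s) ^ 2 * blockSum β 1 κ₀ := by
        simp only [d, blockSum, Finset.sum_filter, Finset.mul_sum, ← Finset.sum_add_distrib]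
        refine Finset.sum_congr rfl fun e _ => ?_
        split_ifs
        · simp only [Pi.one_apply]; ring
        · ring
      rw [h1, hc κ₀ (Finset.mem_insert_self _ _), ← hs2]
      field_simp
      ring
    have hpt (ω : Ω) (t : ℝ) :
        p ω * Real.exp (∑ κ ∈ S, blockSum β (X ω) κ ^ 2 / blockSum β 1 κ / (4 * v)
          + ∑ e, d t e * X ω e) * Real.exp (-v * t ^ 2) =
        p ω * Real.exp (∑ κ ∈ S, blockSum β (X ω) κ ^ 2 / blockSum β 1 κ / (4 * v)
          + ∑ e, c e * X ω e) * Real.exp (t * (blockSum β (X ω) κ₀ / s) - v * t ^ 2) := by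
      rw [hdX, mul_assoc, mul_assoc, ← Real.exp_add, ← Real.exp_add]
      congr 2
      ring
    have hle (t : ℝ) : ∑ ω, p ω * Real.exp
          (∑ κ ∈ S, blockSum β (X ω) κ ^ 2 / blockSum β 1 κ / (4 * v)
          + ∑ e, c e * X ω e) * Real.exp (t * (blockSum β (X ω) κ₀ / s) - v * t ^ 2)
        ≤ √2 ^ S.card * Real.exp (v * (∑ e, c e ^ 2) / 2) * Real.exp (-(v / 2) * t ^ 2) := by
      simp_rw [← hpt]
      rw [← Finset.sum_mul]
      refine (mul_le_mul_of_nonneg_right (ih (d t) (hd t)) (Real.exp_nonneg _)).trans (le_of_eq ?_)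
      rw [hd2, mul_assoc, mul_assoc, ← Real.exp_add, ← Real.exp_add]
      congr 2
      ring
    have hint := integral_mono
      (integrable_finsetSum _ fun ω _ =>
        ((gaussian_linearization hv (blockSum β (X ω) κ₀ / s)).1.const_mul _))
      ((integrable_exp_neg_mul_sq (half_pos hv)).const_mul _) hle
    rw [integral_finsetSum _ fun ω _ =>
        ((gaussian_linearization hv (blockSum β (X ω) κ₀ / s)).1.const_mul _),
      integral_const_mul, integral_gaussian] at hint
    simp_rw [integral_const_mul, (gaussian_linearization hv _).2] at hint
    -- The sub-Gaussian bound turns the weight `exp (-v t²)` into `exp (-v t² / 2)`; the ratio of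
    -- the two Gaussian integrals is the factor `√2`.
    have hpi : √(Real.pi / (v / 2)) = √2 * √(Real.pi / v) := by
      rw [← Real.sqrt_mul (by norm_num)]
      congr 1
      field_simp
    have hpos : 0 < √(Real.pi / v) := Real.sqrt_pos.2 (by positivity)
    refine le_of_mul_le_mul_right ?_ hpos
    rw [Finset.sum_mul]
    refine le_trans (le_of_eq ?_) (hint.trans (le_of_eq ?_))
    · refine Finset.sum_congr rfl fun ω _ => ?_
      rw [div_pow, hs2, add_assoc, Real.exp_add]
      ring
    · rw [hpi]; ring

/-- The residual of `θ` after averaging over the blocks of `β`. -/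
noncomputable def blockResidual (β : E → K) (θ : E → ℝ) (e : E) : ℝ :=
  θ e - blockSum β θ (β e) / blockSum β 1 (β e)

lemma blockSum_blockResidual (β : E → K) (θ : E → ℝ) (κ : K) :
    blockSum β (blockResidual β θ) κ = 0 := by
  have h : blockSum β (blockResidual β θ) κ =
      blockSum β θ κ - blockSum β θ κ / blockSum β 1 κ * blockSum β 1 κ := by
    simp only [blockSum, blockResidual, Finset.mul_sum, ← Finset.sum_sub_distrib]
    refine Finset.sum_congr rfl fun e he => ?_
    rw [(Finset.mem_filter.1 he).2]
    simp
  rw [h]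
  by_cases hn : blockSum β (1 : E → ℝ) κ = 0
  · have hempty : ∀ e ∈ Finset.univ.filter (β · = κ), False := by
      intro e he
      have : (0 : ℝ) < blockSum β 1 κ :=
        Finset.sum_pos (fun _ _ => zero_lt_one) ⟨e, he⟩
      linarith
    have : blockSum β θ κ = 0 := Finset.sum_eq_zero fun e he => (hempty e he).elim
    simp [this]
  · rw [div_mul_cancel₀ _ hn, sub_self]

/-- The supremum over block-wise constant matrices of the offset linear functional. -/
noncomputable def offsetSup [Fintype K] (β : E → K) (θ Y : E → ℝ) : ℝ :=
  4 * ∑ κ, blockSum β Y κ ^ 2 / blockSum β 1 κ - 4 * ∑ e, blockResidual β θ e * Y e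
    - ∑ e, blockResidual β θ e ^ 2

/-- The error is a block-constant part minus the residual of `θ`, and these are orthogonal. On a
block of size `m` with noise sum `y`, the quadratic `4 r y - r² m` is at most `4 y² / m`. -/
lemma sum_offset_le [Fintype K] (β : E → K) (θ Y : E → ℝ) (q : K → ℝ) :
    ∑ e, (4 * (Y e * (q (β e) - θ e)) - (q (β e) - θ e) ^ 2) ≤ offsetSup β θ Y := by
  set u := blockResidual β θ with hu
  let r (κ : K) : ℝ := q κ - blockSum β θ κ / blockSum β 1 κ
  have hr (e : E) : q (β e) - θ e = r (β e) - u e := by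
    simp only [r, hu, blockResidual]; ring
  have h1 : ∑ e, (4 * (Y e * (q (β e) - θ e)) - (q (β e) - θ e) ^ 2) =
      (4 * ∑ e, r (β e) * Y e - ∑ e, r (β e) ^ 2 * (1 : E → ℝ) e)
        + 2 * ∑ e, r (β e) * u e - 4 * ∑ e, u e * Y e - ∑ e, u e ^ 2 := by
    simp only [Finset.mul_sum, ← Finset.sum_add_distrib, ← Finset.sum_sub_distrib, hr,
      Pi.one_apply]
    exact Finset.sum_congr rfl fun e _ => by ring
  have h2 := sum_comp_mul β r u
  simp only [hu, blockSum_blockResidual, mul_zero, Finset.sum_const_zero] at h2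
  rw [h1, hu, h2, sum_comp_mul β r Y, sum_comp_mul β (fun κ => r κ ^ 2) 1, offsetSup]
  have h3 : 4 * ∑ κ, r κ * blockSum β Y κ - ∑ κ, r κ ^ 2 * blockSum β 1 κ ≤
      4 * ∑ κ, blockSum β Y κ ^ 2 / blockSum β 1 κ := by
    rw [Finset.mul_sum, Finset.mul_sum, ← Finset.sum_sub_distrib]
    refine Finset.sum_le_sum fun κ _ => ?_
    have hn0 : 0 ≤ blockSum β (1 : E → ℝ) κ := Finset.sum_nonneg fun _ _ => zero_le_one
    rcases hn0.eq_or_lt with hn | hn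
    · have : blockSum β Y κ = 0 := by
        refine Finset.sum_eq_zero fun e he => ?_
        have : (0 : ℝ) < blockSum β 1 κ :=
          Finset.sum_pos (fun _ _ => zero_lt_one) ⟨e, he⟩
        linarith
      simp [← hn, this]
    · rw [← mul_div_assoc, le_div_iff₀ hn]
      nlinarith [sq_nonneg (r κ * blockSum β 1 κ - 2 * blockSum β Y κ)]
  linarith

/-- After division by `16 v` the linear term has exponential cost `‖u‖² / (32 v)`, which the offset
`-‖u‖² / (16 v)` more than pays for. Only the block factors remain, so the bound does not depend on
how far `θ` is from the model `β`. -/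
lemma sum_exp_offsetSup_le [Fintype K] {p : Ω → ℝ} {X : Ω → E → ℝ} {v : ℝ} (hv : 0 < v)
    (hX : ∀ c : E → ℝ, ∑ ω, p ω * Real.exp (∑ e, c e * X ω e)
      ≤ Real.exp (v * (∑ e, c e ^ 2) / 2)) (β : E → K) (θ : E → ℝ) :
    ∑ ω, p ω * Real.exp (offsetSup β θ (X ω) / (16 * v)) ≤ √2 ^ Fintype.card K := by
  set u := blockResidual β θ with hu
  set U := ∑ e, u e ^ 2 with hU
  have hU0 : 0 ≤ U := Finset.sum_nonneg fun _ _ => sq_nonneg _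
  have h := sum_exp_block_le hv hX β Finset.univ (fun e => -(1 / (4 * v)) * u e) (fun κ _ => by
    have := blockSum_blockResidual β θ κ
    simp only [blockSum] at this ⊢
    rw [← Finset.mul_sum, this, mul_zero])
  have hc : ∑ e, (-(1 / (4 * v)) * u e) ^ 2 = U / (16 * v ^ 2) := by
    simp only [mul_pow, ← Finset.mul_sum, hU]
    field_simp
    ring
  rw [hc] at h
  have he (ω : Ω) : p ω * Real.exp (offsetSup β θ (X ω) / (16 * v)) =
      p ω * Real.exp (∑ κ, blockSum β (X ω) κ ^ 2 / blockSum β 1 κ / (4 * v)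
        + ∑ e, -(1 / (4 * v)) * u e * X ω e) * Real.exp (-U / (16 * v)) := by
    rw [mul_assoc, ← Real.exp_add, ← Finset.sum_div]
    simp only [mul_assoc, ← Finset.mul_sum, offsetSup, ← hu, ← hU]
    congr 2
    field_simp
    ring
  simp_rw [he]
  rw [← Finset.sum_mul]
  refine (mul_le_mul_of_nonneg_right h (Real.exp_nonneg _)).trans ?_
  rw [mul_assoc, ← Real.exp_add, Finset.card_univ]
  refine mul_le_of_le_one_right (by positivity) (Real.exp_le_one_iff.2 ?_)
  have : v * (U / (16 * v ^ 2)) / 2 + -U / (16 * v) = -(U / (32 * v)) := by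
    field_simp
    ring
  rw [this, neg_nonpos]
  positivity

/-- Exponential moment of the error of least squares over a finite union of block models. -/
theorem sum_exp_leastSquares_le [Fintype K] {Z : Type*} [Fintype Z] {p : Ω → ℝ} (hp : ∀ ω, 0 ≤ p ω)
    {X : Ω → E → ℝ} {v : ℝ} (hv : 0 < v)
    (hX : ∀ c : E → ℝ, ∑ ω, p ω * Real.exp (∑ e, c e * X ω e)
      ≤ Real.exp (v * (∑ e, c e ^ 2) / 2)) (β : Z → E → K) (θ : E → ℝ) {M : Ω → ℝ}
    (hM : ∀ ω, ∃ (z : Z) (q : K → ℝ), M ω = ∑ e, (q (β z e) - θ e) ^ 2 ∧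
      ∑ e, (θ e + X ω e - q (β z e)) ^ 2 ≤ ∑ e, X ω e ^ 2) :
    ∑ ω, p ω * Real.exp (M ω / (16 * v)) ≤ Fintype.card Z * √2 ^ Fintype.card K := by
  -- The selected assignment depends on the data, so its term is bounded by the sum over all
  -- assignments. Minimality gives `M ≤ 2⟨X, d⟩`, whence `M = 2M - M ≤ 4⟨X, d⟩ - ‖d‖²`.
  have key (ω : Ω) : Real.exp (M ω / (16 * v)) ≤
      ∑ z, Real.exp (offsetSup (β z) θ (X ω) / (16 * v)) := by
    obtain ⟨z, q, hMω, hls⟩ := hM ω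
    refine le_trans (Real.exp_le_exp.2 (div_le_div_of_nonneg_right ?_ (by positivity)))
      (Finset.single_le_sum (f := fun z => Real.exp (offsetSup (β z) θ (X ω) / (16 * v)))
        (fun _ _ => Real.exp_nonneg _) (Finset.mem_univ z))
    refine le_trans ?_ (sum_offset_le (β z) θ (X ω) q)
    have h1 : ∑ e, (θ e + X ω e - q (β z e)) ^ 2 = ∑ e, X ω e ^ 2
        - 2 * ∑ e, X ω e * (q (β z e) - θ e) + ∑ e, (q (β z e) - θ e) ^ 2 := by
      simp only [Finset.mul_sum, ← Finset.sum_add_distrib, ← Finset.sum_sub_distrib]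
      exact Finset.sum_congr rfl fun e _ => by ring
    rw [Finset.sum_sub_distrib, ← Finset.mul_sum, hMω]
    linarith
  calc ∑ ω, p ω * Real.exp (M ω / (16 * v))
      ≤ ∑ ω, p ω * ∑ z, Real.exp (offsetSup (β z) θ (X ω) / (16 * v)) :=
        Finset.sum_le_sum fun ω _ => mul_le_mul_of_nonneg_left (key ω) (hp ω)
    _ = ∑ z, ∑ ω, p ω * Real.exp (offsetSup (β z) θ (X ω) / (16 * v)) := by
        simp_rw [Finset.mul_sum]
        exact Finset.sum_comm
    _ ≤ ∑ _z : Z, √2 ^ Fintype.card K :=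
        Finset.sum_le_sum fun z _ => sum_exp_offsetSup_le hv hX (β z) θ
    _ = Fintype.card Z * √2 ^ Fintype.card K := by simp

end Blocks

/-! ### From adjacency matrices to edge vectors. -/

/-- The unordered pairs of distinct nodes, each represented by `(i, j)` with `i < j`. -/
abbrev EdgeIndex (n : ℕ) : Type := {p : Fin n × Fin n // p.1 < p.2}

lemma sum_sum_lt_eq {n : ℕ} (f : Fin n → Fin n → ℝ) :
    ∑ i, ∑ j, (if i < j then f i j else 0) = ∑ e : EdgeIndex n, f e.1.1 e.1.2 := by
  rw [← Fintype.sum_prod_type' (f := fun i j : Fin n => if i < j then f i j else 0),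
    ← Finset.sum_filter]
  exact Finset.sum_subtype _ (by simp) fun p : Fin n × Fin n => f p.1 p.2

lemma sum_sum_eq_two_mul {n : ℕ} (f : Fin n → Fin n → ℝ) (hs : ∀ i j, f i j = f j i)
    (hd : ∀ i, f i i = 0) : ∑ i, ∑ j, f i j = 2 * ∑ e : EdgeIndex n, f e.1.1 e.1.2 := by
  have h (i j : Fin n) : f i j = (if i < j then f i j else 0) + if j < i then f j i else 0 := by
    rcases lt_trichotomy i j with h | rfl | h
    · simp [h, h.not_gt]
    · simp [hd]
    · simp [h, h.not_gt, hs i j]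
  have h2 : ∑ i, ∑ j, (if j < i then f j i else 0) = ∑ e : EdgeIndex n, f e.1.1 e.1.2 := by
    rw [Finset.sum_comm, sum_sum_lt_eq]
  rw [← sum_sum_lt_eq] at h2 ⊢
  rw [two_mul]
  nth_rewrite 2 [← h2]
  simp_rw [← Finset.sum_add_distrib, ← h]

/-- The block of a pair of nodes under the assignment `z`. -/
def pairBlock {n k : ℕ} (z : Fin n → Fin k) (e : EdgeIndex n) : Sym2 (Fin k) :=
  s(z e.1.1, z e.1.2)

lemma normSqError_eq {n k : ℕ} {A : Fin n → Fin n → Bool} {T θ : Fin n → Fin n → ℝ}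
    (hT : IsLeastSquaresEstimate k A T) (hθ : θ ∈ blockMatrices n k) :
    normSqError T θ =
      2 / (n : ℝ) ^ 2 * ∑ e : EdgeIndex n, (T e.1.1 e.1.2 - θ e.1.1 e.1.2) ^ 2 := by
  obtain ⟨Q, z, hQ, -, hd, ho⟩ := hT
  obtain ⟨Q', z', -, hQ', hd', ho'⟩ := hθ
  rw [normSqError, sum_sum_eq_two_mul (fun i j => (T i j - θ i j) ^ 2)]
  · ring
  · intro i j
    by_cases h : i = j
    · rw [h]
    · rw [ho i j h, ho j i (Ne.symm h), ho' i j h, ho' j i (Ne.symm h), hQ, hQ']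
  · intro i
    simp [hd, hd']

/-- The noise `A - θ`. -/
def noise {n : ℕ} (θ : Fin n → Fin n → ℝ) (A : Fin n → Fin n → Bool) (e : EdgeIndex n) : ℝ :=
  (if A e.1.1 e.1.2 then 1 else 0) - θ e.1.1 e.1.2

/-- The true `θ` comes from a competitor in the minimization, and its residual is exactly the noise.
-/
lemma leastSquares_basic {n k : ℕ} {A : Fin n → Fin n → Bool} {T θ : Fin n → Fin n → ℝ}
    (hT : IsLeastSquaresEstimate k A T) (hθ : θ ∈ blockMatrices n k) :
    ∃ (z : Fin n → Fin k) (q : Sym2 (Fin k) → ℝ),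
      ∑ e : EdgeIndex n, (T e.1.1 e.1.2 - θ e.1.1 e.1.2) ^ 2 =
        ∑ e : EdgeIndex n, (q (pairBlock z e) - θ e.1.1 e.1.2) ^ 2 ∧
      ∑ e : EdgeIndex n, (θ e.1.1 e.1.2 + noise θ A e - q (pairBlock z e)) ^ 2 ≤
        ∑ e : EdgeIndex n, noise θ A e ^ 2 := by
  obtain ⟨Q, z, hQ, hmin, -, ho⟩ := hT
  obtain ⟨Q', z', -, hQ', -, ho'⟩ := hθ
  refine ⟨z, Sym2.lift ⟨Q, hQ⟩, ?_, ?_⟩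
  · refine Finset.sum_congr rfl fun e _ => ?_
    rw [ho _ _ e.2.ne, pairBlock, Sym2.lift_mk]
  · have h := hmin Q' z' hQ'
    simp only [leastSquaresLoss] at h
    rw [sum_sum_lt_eq (fun i j => ((if A i j then (1 : ℝ) else 0) - Q (z i) (z j)) ^ 2),
      sum_sum_lt_eq (fun i j => ((if A i j then (1 : ℝ) else 0) - Q' (z' i) (z' j)) ^ 2)] at h
    refine (le_of_eq ?_).trans (h.trans (le_of_eq ?_))
    · refine Finset.sum_congr rfl fun e _ => ?_
      rw [noise, add_sub_cancel, pairBlock, Sym2.lift_mk]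
    · refine Finset.sum_congr rfl fun e _ => ?_
      rw [noise, ho' _ _ e.2.ne]

lemma measurable_adjacency {n : ℕ} (ω : Sym2 (Fin n) → ℤ) : Measurable (adjacency ω) := by
  refine measurable_pi_lambda _ fun i => measurable_pi_lambda _ fun j => ?_
  unfold adjacency
  split_ifs
  · exact measurable_const
  · exact measurable_pi_apply _

lemma integrable_comp_adjacency {n : ℕ} (ω : Sym2 (Fin n) → ℤ) (μ : Measure (ℤ → Bool))
    [IsFiniteMeasure μ] (F : (Fin n → Fin n → Bool) → ℝ) :
    Integrable (fun B => F (adjacency ω B)) μ :=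
  (Integrable.of_finite (μ := μ.map (adjacency ω)) (f := F)).comp_measurable
    (measurable_adjacency ω)

lemma integral_comp_adjacency {n : ℕ} (ω : Sym2 (Fin n) → ℤ) (μ : Measure (ℤ → Bool))
    [IsFiniteMeasure μ] (F : (Fin n → Fin n → Bool) → ℝ) :
    ∫ B, F (adjacency ω B) ∂μ = ∑ A, (μ.map (adjacency ω)).real {A} * F A := by
  rw [← integral_map (measurable_adjacency ω).aemeasurable
    (measurable_of_finite F).aestronglyMeasurable, integral_fintype .of_finite]
  rfl

lemma one_le_numPairs {n : ℕ} (hn : 2 ≤ n) : 1 ≤ numPairs n := by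
  unfold numPairs
  rw [Nat.le_div_iff_mul_le (by norm_num)]
  exact (Nat.mul_le_mul hn (by lia : 1 ≤ n - 1)).trans' (by norm_num)

lemma integral_exp_noise_le {n l : ℕ} {α : ℝ} {ω : Sym2 (Fin n) → ℤ} {θ : Fin n → Fin n → ℝ}
    {μ : Measure (ℤ → Bool)} [IsProbabilityMeasure μ] (hn : 2 ≤ n) (hα : 0 < α)
    (hω : IsEdgeOrder n ω) (hμ : IsEdgeLaw n l α ω θ μ) (c : EdgeIndex n → ℝ) :
    ∫ B, Real.exp (∑ e, c e * noise θ (adjacency ω B) e) ∂μ ≤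
      Real.exp (1 / (1 - chi l α) ^ 2 * (∑ e, c e ^ 2) / 2) := by
  classical
  let idx (e : EdgeIndex n) : ℕ := (ω s(e.1.1, e.1.2) - 1).toNat
  have hmem (e : EdgeIndex n) : ω s(e.1.1, e.1.2) ∈ Set.Icc 1 (numPairs n : ℤ) :=
    hω.mapsTo (by simpa using e.2.ne)
  have hidx (e : EdgeIndex n) : (idx e : ℤ) + 1 = ω s(e.1.1, e.1.2) := by
    have := (hmem e).1
    simp only [idx]; lia
  have hrange (e : EdgeIndex n) : idx e ∈ Finset.range (numPairs n) := by
    have := (hmem e).2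
    have := hidx e
    rw [Finset.mem_range]; lia
  have hinj : Function.Injective idx := by
    intro e e' h
    have h1 : ω s(e.1.1, e.1.2) = ω s(e'.1.1, e'.1.2) := by rw [← hidx, ← hidx, h]
    have h2 := hω.injOn (by simpa using e.2.ne) (by simpa using e'.2.ne) h1
    rcases Sym2.eq_iff.1 h2 with ⟨h3, h4⟩ | ⟨h3, h4⟩
    · exact Subtype.ext (Prod.ext h3 h4)
    · have := e.2
      rw [h3, h4] at this
      exact absurd this e'.2.not_gt
  -- The coefficients are carried to time order; `idx` is shifted by one because `ω` starts at `1`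
  -- and `Finset.range` at `0`.
  let c' (r : ℕ) : ℝ := ∑ e, if idx e = r then c e else 0
  have hc' (e : EdgeIndex n) : c' (idx e) = c e := by
    simp only [c', hinj.eq_iff, Finset.sum_ite_eq', Finset.mem_univ, if_true]
  have hsum (f : ℕ → ℝ) : ∑ r ∈ Finset.range (numPairs n), c' r * f r = ∑ e, c e * f (idx e) := by
    simp only [c', Finset.sum_mul, ite_mul, zero_mul]
    rw [Finset.sum_comm]
    refine Finset.sum_congr rfl fun e _ => ?_
    rw [Finset.sum_ite_eq, if_pos (hrange e)]
  have hsq : ∑ r ∈ Finset.range (numPairs n), c' r ^ 2 = ∑ e, c e ^ 2 := by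
    simp only [sq, hsum, hc']
  have key := integral_exp_sum_centered_le hα (one_le_numPairs hn) hμ.burnIn hμ.markov
    hμ.transition c'
  rw [hsq] at key
  refine le_trans (le_of_eq ?_) key
  congr 1
  ext B
  rw [hsum]
  congr 1
  refine Finset.sum_congr rfl fun e _ => ?_
  have ha (B : ℤ → Bool) : adjacency ω B e.1.1 e.1.2 = B (ω s(e.1.1, e.1.2)) := by
    simp [adjacency, e.2.ne]
  have hm := hμ.marginal _ _ e.2.ne
  simp only [ha] at hm
  rw [hidx, noise, ha, hm, coord]

lemma card_sym2_le (k : ℕ) : Fintype.card (Sym2 (Fin k)) ≤ k ^ 2 := by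
  rw [Sym2.card, Fintype.card_fin, sq]
  exact (Nat.choose_two_right (k + 1)).trans_le <| by
    rw [Nat.add_sub_cancel]
    refine Nat.div_le_of_le_mul ?_
    nlinarith [Nat.le_mul_self k]

lemma sqrt_two_pow_le (k : ℕ) : √2 ^ Fintype.card (Sym2 (Fin k)) ≤ Real.exp ((k : ℝ) ^ 2) := by
  have h1 : (1 : ℝ) ≤ √2 := by rw [Real.one_le_sqrt]; norm_num
  have h2 : √2 ≤ Real.exp 1 := by
    have h3 := Real.add_one_le_exp (1 : ℝ)
    have h4 : √2 ≤ 2 := by rw [Real.sqrt_le_left (by norm_num)]; norm_num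
    linarith
  calc √2 ^ Fintype.card (Sym2 (Fin k)) ≤ √2 ^ (k ^ 2) := pow_le_pow_right₀ h1 (card_sym2_le k)
    _ ≤ Real.exp 1 ^ (k ^ 2) := pow_le_pow_left₀ (by positivity) h2 _
    _ = Real.exp ((k : ℝ) ^ 2) := by rw [← Real.exp_nat_mul]; push_cast; rw [mul_one]

/-- The rate `k² / n² + log k / n`. -/
noncomputable def rate (n k : ℕ) : ℝ := (k : ℝ) ^ 2 / (n : ℝ) ^ 2 + Real.log k / n

lemma rate_nonneg (n k : ℕ) : 0 ≤ rate n k :=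
  add_nonneg (by positivity) (div_nonneg (Real.log_natCast_nonneg k) (by positivity))

lemma sq_mul_rate {n : ℕ} (hn : 1 ≤ n) (k : ℕ) :
    (n : ℝ) ^ 2 * rate n k = k ^ 2 + n * Real.log k := by
  have : (n : ℝ) ≠ 0 := by positivity
  unfold rate
  field_simp

/-! ### Bounds conditional on the latent variables. -/

section Estimate
variable {n k l : ℕ} {α : ℝ} {ω : Sym2 (Fin n) → ℤ}
  {est : (Fin n → Fin n → Bool) → Fin n → Fin n → ℝ} {θ : Fin n → Fin n → ℝ}
  {μ : Measure (ℤ → Bool)} [IsProbabilityMeasure μ]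

lemma normSqError_nonneg {n : ℕ} (S T : Fin n → Fin n → ℝ) : 0 ≤ normSqError S T :=
  mul_nonneg (by positivity) (Finset.sum_nonneg fun _ _ => Finset.sum_nonneg fun _ _ => sq_nonneg _)

/-- Exponential moment of the least-squares error. -/
theorem integral_exp_normSqError_le (hn : 2 ≤ n) (hk : 1 ≤ k) (hα : 0 < α)
    (hω : IsEdgeOrder n ω) (hest : ∀ A, IsLeastSquaresEstimate k A (est A))
    (hθ : θ ∈ blockMatrices n k) (hμ : IsEdgeLaw n l α ω θ μ) :
    ∫ B, Real.exp ((n : ℝ) ^ 2 * (1 - chi l α) ^ 2 / 32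
        * normSqError (est (adjacency ω B)) θ) ∂μ ≤
      Real.exp ((n : ℝ) ^ 2 * rate n k) := by
  obtain ⟨-, hχ⟩ := chi_nonneg_lt_one hα (one_le_numPairs hn) hμ.transition
  have hχ' : 0 < 1 - chi l α := sub_pos.2 hχ
  have hn0 : (0 : ℝ) < n := by positivity
  have hsub (c : EdgeIndex n → ℝ) :
      ∑ A, (μ.map (adjacency ω)).real {A} * Real.exp (∑ e, c e * noise θ A e) ≤
        Real.exp (1 / (1 - chi l α) ^ 2 * (∑ e, c e ^ 2) / 2) := by
    rw [← integral_comp_adjacency ω μ fun A => Real.exp (∑ e, c e * noise θ A e)]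
    exact integral_exp_noise_le hn hα hω hμ c
  have key := sum_exp_leastSquares_le (p := fun A => (μ.map (adjacency ω)).real {A})
    (fun _ => measureReal_nonneg) (one_div_pos.2 (pow_pos hχ' 2)) hsub
    (pairBlock (n := n) (k := k)) (fun e => θ e.1.1 e.1.2) fun A => leastSquares_basic (hest A) hθ
  -- The constant `32` is `16` from the offset bound times `2`, as the loss counts each edge twice.
  have hexp (A : Fin n → Fin n → Bool) : (n : ℝ) ^ 2 * (1 - chi l α) ^ 2 / 32
      * normSqError (est A) θ = (∑ e : EdgeIndex n, (est A e.1.1 e.1.2 - θ e.1.1 e.1.2) ^ 2) /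
        (16 * (1 / (1 - chi l α) ^ 2)) := by
    rw [normSqError_eq (hest A) hθ]
    field_simp
    ring
  rw [integral_comp_adjacency ω μ fun A => Real.exp ((n : ℝ) ^ 2 * (1 - chi l α) ^ 2 / 32
        * normSqError (est A) θ)]
  simp_rw [hexp]
  refine key.trans ?_
  rw [sq_mul_rate (by lia), add_comm, Real.exp_add, Real.exp_nat_mul,
    Real.exp_log (by exact_mod_cast hk)]
  simp only [Fintype.card_fun, Fintype.card_fin, Nat.cast_pow]
  exact mul_le_mul_of_nonneg_left (sqrt_two_pow_le k) (by positivity)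

lemma normSqError_eq_zero_of_lt_two (hn : n < 2)
    (hest : ∀ A, IsLeastSquaresEstimate k A (est A)) (hθ : θ ∈ blockMatrices n k)
    (A : Fin n → Fin n → Bool) : normSqError (est A) θ = 0 := by
  obtain ⟨Q, z, -, -, hd, -⟩ := hest A
  obtain ⟨Q', z', -, -, hd', -⟩ := hθ
  have h (i j : Fin n) : (est A i j - θ i j) ^ 2 = 0 := by
    obtain rfl : i = j := Fin.ext (by lia)
    simp [hd, hd']
  simp [normSqError, h]

theorem measureReal_normSqError_le {C' : ℝ} (hC' : 0 < C') (hn : 1 ≤ n) (hk : 1 ≤ k) (hα : 0 < α)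
    (hω : IsEdgeOrder n ω) (hest : ∀ A, IsLeastSquaresEstimate k A (est A))
    (hθ : θ ∈ blockMatrices n k) (hμ : IsEdgeLaw n l α ω θ μ) :
    1 - Real.exp (-C' * n * Real.log k) ≤
      μ.real {B | normSqError (est (adjacency ω B)) θ ≤
        32 * (1 + C') * rate n k / (1 - chi l α) ^ 2} := by
  have hr := rate_nonneg n k
  -- Without edges the transition bound is vacuous and `χ < 1` is unavailable, but the loss
  -- vanishes.
  rcases lt_or_ge n 2 with hn2 | hn2
  · have : {B | normSqError (est (adjacency ω B)) θ ≤
        32 * (1 + C') * rate n k / (1 - chi l α) ^ 2} = Set.univ := by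
      refine Set.eq_univ_of_forall fun B => ?_
      rw [Set.mem_ofPred_eq, normSqError_eq_zero_of_lt_two hn2 hest hθ]
      positivity
    rw [this, probReal_univ]
    linarith [Real.exp_pos (-C' * n * Real.log k)]
  obtain ⟨-, hχ⟩ := chi_nonneg_lt_one hα (one_le_numPairs hn2) hμ.transition
  have hχ' : 0 < 1 - chi l α := sub_pos.2 hχ
  have hn0 : (0 : ℝ) < n := by positivity
  set a := (n : ℝ) ^ 2 * (1 - chi l α) ^ 2 / 32 with ha
  set t := 32 * (1 + C') * rate n k / (1 - chi l α) ^ 2 with ht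
  -- Of the `1 + C'` multiples of `n² * rate`, one absorbs the exponential moment and `C'` remain
  -- for the tail.
  have hat : a * t = (1 + C') * ((n : ℝ) ^ 2 * rate n k) := by
    rw [ha, ht]; field_simp
  set D : (ℤ → Bool) → ℝ := fun B => normSqError (est (adjacency ω B)) θ with hD
  have hDm : Measurable D :=
    (measurable_of_finite fun A => normSqError (est A) θ).comp (measurable_adjacency ω)
  have hmarkov := mul_meas_ge_le_integral_of_nonneg (μ := μ)
    (f := fun B => Real.exp (a * D B)) (.of_forall fun _ => Real.exp_nonneg _)
    (integrable_comp_adjacency ω μ fun A => Real.exp (a * normSqError (est A) θ))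
    (Real.exp (a * t))
  have hbad : μ.real {B | D B ≤ t}ᶜ ≤ Real.exp (-C' * n * Real.log k) := by
    have hsub : {B | D B ≤ t}ᶜ ⊆ {B | Real.exp (a * t) ≤ Real.exp (a * D B)} := by
      intro B hB
      have hB' : t < D B := not_le.1 hB
      exact Real.exp_le_exp.2 (mul_le_mul_of_nonneg_left hB'.le (by positivity))
    refine (measureReal_mono hsub).trans ?_
    have h2 := hmarkov.trans (integral_exp_normSqError_le hn2 hk hα hω hest hθ hμ)
    rw [← le_div_iff₀' (Real.exp_pos _), ← Real.exp_sub, hat] at h2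
    rw [hat]
    refine h2.trans (Real.exp_le_exp.2 ?_)
    rw [sq_mul_rate hn]
    nlinarith [mul_nonneg hC'.le (sq_nonneg (k : ℝ))]
  have := probReal_add_probReal_compl (μ := μ)
    (measurableSet_le hDm measurable_const : MeasurableSet {B | D B ≤ t})
  change 1 - _ ≤ μ.real {B | D B ≤ t}
  linarith

theorem integral_normSqError_le (hn : 1 ≤ n) (hk : 1 ≤ k) (hα : 0 < α)
    (hω : IsEdgeOrder n ω) (hest : ∀ A, IsLeastSquaresEstimate k A (est A))
    (hθ : θ ∈ blockMatrices n k) (hμ : IsEdgeLaw n l α ω θ μ) :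
    ∫ B, normSqError (est (adjacency ω B)) θ ∂μ ≤ 32 * rate n k / (1 - chi l α) ^ 2 := by
  have hr := rate_nonneg n k
  rcases lt_or_ge n 2 with hn2 | hn2
  · simp_rw [normSqError_eq_zero_of_lt_two hn2 hest hθ]
    rw [integral_zero]
    positivity
  obtain ⟨-, hχ⟩ := chi_nonneg_lt_one hα (one_le_numPairs hn2) hμ.transition
  have hχ' : 0 < 1 - chi l α := sub_pos.2 hχ
  have hn0 : (0 : ℝ) < n := by positivity
  have hexp := integral_exp_normSqError_le hn2 hk hα hω hest hθ hμ
  set a := (n : ℝ) ^ 2 * (1 - chi l α) ^ 2 / 32 with ha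
  set s := (n : ℝ) ^ 2 * rate n k with hs
  -- Jensen's inequality through the tangent line `x ≤ s - 1 + exp (x - s)`, taken at the logarithm
  -- `s` of the moment bound.
  have h1 : ∫ B, a * normSqError (est (adjacency ω B)) θ ∂μ ≤
      ∫ B, (s - 1 + Real.exp (-s) * Real.exp (a * normSqError (est (adjacency ω B)) θ)) ∂μ := by
    refine integral_mono
      ((integrable_comp_adjacency ω μ fun A => normSqError (est A) θ).const_mul _)
      ((integrable_const _).add ((integrable_comp_adjacency ω μ
        fun A => Real.exp (a * normSqError (est A) θ)).const_mul _)) fun B => ?_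
    simp only [← Real.exp_add]
    linarith [Real.add_one_le_exp (-s + a * normSqError (est (adjacency ω B)) θ)]
  rw [integral_add (integrable_const _) ((integrable_comp_adjacency ω μ
        fun A => Real.exp (a * normSqError (est A) θ)).const_mul _),
    integral_const_mul, integral_const_mul, integral_const, probReal_univ, one_smul] at h1
  have h2 := mul_le_mul_of_nonneg_left hexp (Real.exp_nonneg (-s))
  rw [← Real.exp_add, neg_add_cancel, Real.exp_zero] at h2
  have h3 : a * ∫ B, normSqError (est (adjacency ω B)) θ ∂μ ≤ s := by linarith
  rw [← le_div_iff₀' (by positivity)] at h3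
  refine h3.trans (le_of_eq ?_)
  rw [ha, hs]
  field_simp

end Estimate

/-! ### Random latent variables. -/

section Joint
variable {n k l : ℕ} {α : ℝ} {ω : Sym2 (Fin n) → ℤ}
  {est : (Fin n → Fin n → Bool) → Fin n → Fin n → ℝ} {f : ℝ → ℝ → ℝ}
  {ν : Measure ℝ} [IsProbabilityMeasure ν] {κ : Kernel (Fin n → ℝ) (ℤ → Bool)} [IsMarkovKernel κ]

lemma graphonMatrix_mem_blockMatrices (hf : IsBlockwiseConstant k f) (ξ : Fin n → ℝ) :
    graphonMatrix f ξ ∈ blockMatrices n k := by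
  obtain ⟨c, Q, -, hQ, hs, h⟩ := hf
  refine ⟨Q, fun i => c (ξ i), hQ, hs, fun i => by simp [graphonMatrix], fun i j hij => ?_⟩
  simp [graphonMatrix, hij, h]

lemma measurable_graphonMatrix (hf : IsBlockwiseConstant k f) (i j : Fin n) :
    Measurable fun ξ : Fin n → ℝ => graphonMatrix f ξ i j := by
  obtain ⟨c, Q, hc, -, -, h⟩ := hf
  unfold graphonMatrix
  split_ifs
  · exact measurable_const
  · simp_rw [h]
    exact (measurable_of_finite fun q : Fin k × Fin k => Q q.1 q.2).comp
      ((hc.comp (measurable_pi_apply i)).prodMk (hc.comp (measurable_pi_apply j)))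

lemma measurable_normSqError (est : (Fin n → Fin n → Bool) → Fin n → Fin n → ℝ)
    (hf : IsBlockwiseConstant k f) : Measurable fun p : (Fin n → ℝ) × (ℤ → Bool) =>
      normSqError (est (adjacency ω p.2)) (graphonMatrix f p.1) := by
  unfold normSqError
  refine (Finset.measurable_sum _ fun i _ => Finset.measurable_sum _ fun j _ => ?_).const_mul _
  refine Measurable.pow_const (Measurable.sub ?_ ?_) 2
  · exact (measurable_of_finite fun A => est A i j).comp
      ((measurable_adjacency ω).comp measurable_snd)
  · exact (measurable_graphonMatrix hf i j).comp measurable_fst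

/-- The loss is bounded because there are finitely many adjacency matrices and `f` takes values in
`[0, 1]`. -/
lemma integrable_normSqError (est : (Fin n → Fin n → Bool) → Fin n → Fin n → ℝ)
    (hf : IsBlockwiseConstant k f) (P : Measure ((Fin n → ℝ) × (ℤ → Bool))) [IsFiniteMeasure P] :
    Integrable (fun p => normSqError (est (adjacency ω p.2)) (graphonMatrix f p.1)) P := by
  set b : (Fin n → Fin n → Bool) → ℝ := fun A =>
    (1 / (n : ℝ) ^ 2) * ∑ i, ∑ j, (|est A i j| + 1) ^ 2 with hb
  have hb0 (A) : 0 ≤ b A := mul_nonneg (by positivity)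
    (Finset.sum_nonneg fun _ _ => Finset.sum_nonneg fun _ _ => sq_nonneg _)
  refine Integrable.of_mem_Icc 0 (∑ A, b A) (measurable_normSqError est hf).aemeasurable
    (.of_forall fun p => ⟨normSqError_nonneg _ _, ?_⟩)
  refine le_trans ?_ (Finset.single_le_sum (fun A _ => hb0 A)
    (Finset.mem_univ (adjacency ω p.2)))
  refine mul_le_mul_of_nonneg_left (Finset.sum_le_sum fun i _ => Finset.sum_le_sum fun j _ => ?_)
    (by positivity)
  rw [← sq_abs]
  refine pow_le_pow_left₀ (abs_nonneg _) ((abs_sub _ _).trans (add_le_add_right ?_ _)) 2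
  obtain ⟨c, Q, -, hQ, -, h⟩ := hf
  unfold graphonMatrix
  split_ifs
  · simp
  · rw [h, abs_of_nonneg (hQ _ _).1]
    exact (hQ _ _).2

instance (n : ℕ) (ν : Measure ℝ) [IsProbabilityMeasure ν] (κ : Kernel (Fin n → ℝ) (ℤ → Bool))
    [IsMarkovKernel κ] : IsProbabilityMeasure (jointLaw n ν κ) := by
  unfold jointLaw; infer_instance

theorem measureReal_jointLaw_normSqError_le {C' : ℝ} (hC' : 0 < C') (hn : 1 ≤ n) (hk : 1 ≤ k)
    (hα : 0 < α) (hω : IsEdgeOrder n ω) (hest : ∀ A, IsLeastSquaresEstimate k A (est A))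
    (hM : IsCompositeSBM n k l α ω ν f κ) :
    1 - Real.exp (-C' * n * Real.log k) ≤
      (jointLaw n ν κ).real {p | normSqError (est (adjacency ω p.2)) (graphonMatrix f p.1) ≤
        32 * (1 + C') * rate n k / (1 - chi l α) ^ 2} := by
  set t := 32 * (1 + C') * rate n k / (1 - chi l α) ^ 2
  have hmeas : MeasurableSet {p : (Fin n → ℝ) × (ℤ → Bool) |
      normSqError (est (adjacency ω p.2)) (graphonMatrix f p.1) ≤ t} :=
    measurableSet_le (measurable_normSqError est hM.blocks) measurable_const
  rw [measureReal_def, ← ENNReal.ofReal_le_iff_le_toReal (measure_ne_top _ _), jointLaw,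
    Measure.compProd_apply hmeas]
  calc ENNReal.ofReal (1 - Real.exp (-C' * n * Real.log k))
      = ∫⁻ _ξ, ENNReal.ofReal (1 - Real.exp (-C' * n * Real.log k))
          ∂(Measure.pi fun _ : Fin n => ν) := by simp
    _ ≤ _ := by
        refine lintegral_mono_ae ?_
        filter_upwards [hM.edges] with ξ hξ
        have h := measureReal_normSqError_le hC' hn hk hα hω hest
          (graphonMatrix_mem_blockMatrices hM.blocks ξ) hξ
        exact (ENNReal.ofReal_le_iff_le_toReal (measure_ne_top _ _)).2 h

theorem integral_jointLaw_normSqError_le (hn : 1 ≤ n) (hk : 1 ≤ k) (hα : 0 < α)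
    (hω : IsEdgeOrder n ω) (hest : ∀ A, IsLeastSquaresEstimate k A (est A))
    (hM : IsCompositeSBM n k l α ω ν f κ) :
    ∫ p, normSqError (est (adjacency ω p.2)) (graphonMatrix f p.1) ∂(jointLaw n ν κ) ≤
      32 * rate n k / (1 - chi l α) ^ 2 := by
  have hint := integrable_normSqError (ω := ω) est hM.blocks (jointLaw n ν κ)
  rw [jointLaw] at hint ⊢
  rw [Measure.integral_compProd hint]
  refine (integral_mono_of_nonneg (g := fun _ => 32 * rate n k / (1 - chi l α) ^ 2)
    (.of_forall fun ξ => integral_nonneg fun B => normSqError_nonneg _ _)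
    (integrable_const _) ?_).trans (by simp)
  filter_upwards [hM.edges] with ξ hξ
  exact integral_normSqError_le hn hk hα hω hest
    (graphonMatrix_mem_blockMatrices hM.blocks ξ) hξ

end Joint

end CompositeSBM

theorem theorem1 :
    (∀ C' : ℝ, 0 < C' → ∃ C : ℝ, 0 < C ∧
      ∀ (n k l : ℕ) (α : ℝ) (ω : Sym2 (Fin n) → ℤ)
        (est : (Fin n → Fin n → Bool) → Fin n → Fin n → ℝ),
        1 ≤ k → k ≤ n → 0 < α → IsEdgeOrder n ω →
        (∀ A, IsLeastSquaresEstimate k A (est A)) →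
        -- conditionally on the latent variables, uniformly over the connection probabilities
        (∀ θ ∈ blockMatrices n k, ∀ (μ : Measure (ℤ → Bool)) [IsProbabilityMeasure μ],
          IsEdgeLaw n l α ω θ μ →
          1 - Real.exp (-C' * n * Real.log k) ≤
            μ.real {B | normSqError (est (adjacency ω B)) θ ≤
              C * ((k : ℝ) ^ 2 / (n : ℝ) ^ 2 + Real.log k / n) / (1 - chi l α) ^ 2}) ∧
        -- with random latent variables
        (∀ (ν : Measure ℝ) [IsProbabilityMeasure ν] (f : ℝ → ℝ → ℝ)
          (κ : Kernel (Fin n → ℝ) (ℤ → Bool)) [IsMarkovKernel κ],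
          IsCompositeSBM n k l α ω ν f κ →
          1 - Real.exp (-C' * n * Real.log k) ≤
            (jointLaw n ν κ).real {p | normSqError (est (adjacency ω p.2)) (graphonMatrix f p.1) ≤
              C * ((k : ℝ) ^ 2 / (n : ℝ) ^ 2 + Real.log k / n) / (1 - chi l α) ^ 2})) ∧
    (∃ C₁ : ℝ, 0 < C₁ ∧
      ∀ (n k l : ℕ) (α : ℝ) (ω : Sym2 (Fin n) → ℤ)
        (est : (Fin n → Fin n → Bool) → Fin n → Fin n → ℝ),
        1 ≤ k → k ≤ n → 0 < α → IsEdgeOrder n ω →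
        (∀ A, IsLeastSquaresEstimate k A (est A)) →
        -- conditionally on the latent variables, uniformly over the connection probabilities
        (∀ θ ∈ blockMatrices n k, ∀ (μ : Measure (ℤ → Bool)) [IsProbabilityMeasure μ],
          IsEdgeLaw n l α ω θ μ →
          Integrable (fun B => normSqError (est (adjacency ω B)) θ) μ ∧
          ∫ B, normSqError (est (adjacency ω B)) θ ∂μ ≤
            C₁ * ((k : ℝ) ^ 2 / (n : ℝ) ^ 2 + Real.log k / n) / (1 - chi l α) ^ 2) ∧
        -- with random latent variables
        (∀ (ν : Measure ℝ) [IsProbabilityMeasure ν] (f : ℝ → ℝ → ℝ)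
          (κ : Kernel (Fin n → ℝ) (ℤ → Bool)) [IsMarkovKernel κ],
          IsCompositeSBM n k l α ω ν f κ →
          Integrable (fun p : (Fin n → ℝ) × (ℤ → Bool) =>
            normSqError (est (adjacency ω p.2)) (graphonMatrix f p.1)) (jointLaw n ν κ) ∧
          ∫ p, normSqError (est (adjacency ω p.2)) (graphonMatrix f p.1) ∂(jointLaw n ν κ) ≤
            C₁ * ((k : ℝ) ^ 2 / (n : ℝ) ^ 2 + Real.log k / n) / (1 - chi l α) ^ 2)) := by
  refine ⟨fun C' hC' => ⟨32 * (1 + C'), by positivity, ?_⟩, 32, by norm_num, ?_⟩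
  · intro n k l α ω est hk hkn hα hω hest
    exact ⟨fun θ hθ μ _ hμ =>
        measureReal_normSqError_le hC' (hk.trans hkn) hk hα hω hest hθ hμ,
      fun ν _ f κ _ hM =>
        measureReal_jointLaw_normSqError_le hC' (hk.trans hkn) hk hα hω hest hM⟩
  · intro n k l α ω est hk hkn hα hω hest
    exact ⟨fun θ hθ μ _ hμ =>
        ⟨integrable_comp_adjacency ω μ fun A => normSqError (est A) θ,
          integral_normSqError_le (hk.trans hkn) hk hα hω hest hθ hμ⟩,
      fun ν _ f κ _ hM =>
        ⟨integrable_normSqError est hM.blocks _,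
          integral_jointLaw_normSqError_le (hk.trans hkn) hk hα hω hest hM⟩⟩
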